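/- Fix $d\ge 3$ and $\epsilon\in(0,1)$. For an integer $N\ge 1$ let $\mathbb T=(\mathbb Z/N\mathbb Z)^d$, write $x\sim y$ when $x,y\in\mathbb T$ are nearest neighbours (at Euclidean distance $1$), let $B=B(0,N^{1-\epsilon/2})\subseteq\mathbb T$ be the closed $\ell_\infty$-ball of radius $N^{1-\epsilon/2}$ centred at $0$, and let $t_N=(N\log N)^2$. Let $(X_n)_{n\ge 0}$ be, under $P_x$, the simple random walk on $\mathbb T$ started at $x$ (the projection to $\mathbb T$ of simple random walk on $\mathbb Z^d$), let $Y_t=X_{N_t}$, $t\ge0$, where $(N_t)_{t\ge0}$ is an independent Poisson process of rate $1$, and let $H_B=\inf\{t\ge 0: Y_t\in B\}$. If $\mathbb T\setminus B\neq\emptyset$, let $P^B=\big(\tfrac1{2d}\mathbf 1_{\{x\sim y\}}\big)_{x,y\in\mathbb T\setminus B}$; the quasistationary distribution $\sigma$ on $\mathbb T\setminus B$ is $\sigma(x)=(v_1)_x/\sum_{z\in\mathbb T\setminus B}(v_1)_z$, where $v_1$ is an eigenvector with non-negative entries belonging to the largest eigenvalue of $P^B$. Then $\sigma$ is well defined (such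 a $v_1$ exists, and $\sigma$ does not depend on its choice), and there is a constant $c_\epsilon>0$, depending only on $d$ and $\epsilon$, such that for every $N\ge1$ with $\mathbb T\setminus B\ne\emptyset$, $$\sup_{x,y\in\mathbb T\setminus B}\big|P_x[Y_{t_N}=y\mid H_B>t_N]-\sigma(y)\big|\le e^{-c_\epsilon\log^2N}.$$ -/

import Mathlib

open MeasureTheory ProbabilityTheory

namespace TorusWalk

noncomputable section

/-- The discrete torus `(ℤ/Nℤ)^d`. -/
abbrev Torus (N d : ℕ) : Type := Fin d → ZMod N

/-- The nearest-neighbour graph on the torus: two distinct vertices are adjacent when one of them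
is obtained from the other by adding a standard basis vector. -/
def torusGraph (N d : ℕ) : SimpleGraph (Torus N d) :=
  SimpleGraph.fromRel fun x y => ∃ i : Fin d, y = x + Pi.single i 1

/-- The closed ball of radius `r` centred at the origin of the torus for the `ℓ^∞`-distance.
The distance to `0` in `ℤ/Nℤ` is the absolute value of the representative of least absolute
value. -/
def box (N d : ℕ) (r : ℝ) : Set (Torus N d) :=
  {x | ∀ i, |((x i).valMinAbs : ℝ)| ≤ r}

/-- The box `B = B(0, N^{1-ε/2})`. -/
def boxB (N d : ℕ) (ε : ℝ) : Set (Torus N d) := box N d ((N : ℝ) ^ (1 - ε / 2))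

/-- The time `(N log N)^2`. -/
def regTime (N : ℕ) : ℝ := ((N : ℝ) * Real.log N) ^ 2

/-! ### The walk

The probability space carries a sequence of independent uniform steps in `{±e_1, …, ±e_d}` and,
independently, the i.i.d. exponential gaps of a Poisson process of rate `1`. -/

/-- Sample space: step indices (a direction and a sign) and gaps of the Poisson process. -/
abbrev Sample (d : ℕ) : Type := (ℕ → Fin d × Bool) × (ℕ → ℝ)

/-- Independent uniform steps, and independently of them i.i.d. `Exp(1)` gaps. -/
def walkMeasure (d : ℕ) : Measure (Sample d) :=
  (Measure.infinitePi fun _ : ℕ => uniformOn (Set.univ : Set (Fin d × Bool))).prod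
    (Measure.infinitePi fun _ : ℕ => expMeasure 1)

/-- The lattice vector `± e_i` with index `(i, ±)`. -/
def stepVec {d : ℕ} (s : Fin d × Bool) : Fin d → ℤ :=
  Pi.single s.1 (if s.2 then 1 else -1)

/-- Simple random walk on `ℤ^d` started at the origin. -/
def latticeWalk {d : ℕ} (n : ℕ) (ω : Sample d) : Fin d → ℤ :=
  ∑ k ∈ Finset.range n, stepVec (ω.1 k)

/-- Simple random walk `X_n` on the torus started at `x`: the projection of the lattice walk,
translated by `x`. -/
def discreteWalk {N d : ℕ} (x : Torus N d) (n : ℕ) (ω : Sample d) : Torus N d :=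
  fun i => x i + ((latticeWalk n ω i : ℤ) : ZMod N)

/-- The time `τ_n` of the `n`-th point of the Poisson process (`τ_0 = 0`). -/
def jumpTime {d : ℕ} (n : ℕ) (ω : Sample d) : ℝ :=
  ∑ k ∈ Finset.range n, ω.2 k

/-- The number `N_t` of points `τ_1, τ_2, …` of the Poisson process in `[0, t]`. -/
def poissonCount {d : ℕ} (t : ℝ) (ω : Sample d) : ℕ :=
  Set.ncard {n : ℕ | 1 ≤ n ∧ jumpTime n ω ≤ t}

/-- The continuous-time random walk `Y_t = X_{N_t}` on the torus started at `x`. -/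
def contWalk {N d : ℕ} (x : Torus N d) (t : ℝ) (ω : Sample d) : Torus N d :=
  discreteWalk x (poissonCount t ω) ω

/-- The entrance time `H_V = inf {t ≥ 0 : Y_t ∈ V}` of the walk started at `x`, with value `⊤` when
`V` is never entered. -/
def entranceTime {N d : ℕ} (x : Torus N d) (V : Set (Torus N d)) (ω : Sample d) : WithTop ℝ :=
  hittingAfter (contWalk x) V 0 ω

/-- The conditional probability `P_x[Y_t = y | H_V > t]`. -/
def condLaw {N d : ℕ} (V : Set (Torus N d)) (t : ℝ) (x y : Torus N d) : ℝ :=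
  ((walkMeasure d)[|{ω | (t : WithTop ℝ) < entranceTime x V ω}]).real {ω | contWalk x t ω = y}

/-! ### The quasistationary distribution -/

open scoped Classical in
/-- The matrix `((2d)⁻¹ 1_{x ∼ y})` with rows and columns indexed by the complement of `V`. -/
def restrictedMatrix {N d : ℕ} (V : Set (Torus N d)) :
    Matrix {x : Torus N d // x ∉ V} {x : Torus N d // x ∉ V} ℝ :=
  fun x y => if (torusGraph N d).Adj x y then 1 / (2 * (d : ℝ)) else 0

open scoped Classical in
/-- `σ` is the quasistationary distribution on the complement of `V`: it is `v / (vᵀ 1)` for an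
eigenvector `v` with non-negative entries that belongs to the largest eigenvalue of the restricted
matrix. -/
def IsQuasistationary {N d : ℕ} [NeZero N] (V : Set (Torus N d))
    (σ : {x : Torus N d // x ∉ V} → ℝ) : Prop :=
  ∃ (l : ℝ) (v : {x : Torus N d // x ∉ V} → ℝ),
    IsGreatest {μ : ℝ | Module.End.HasEigenvalue (Matrix.toLin' (restrictedMatrix V)) μ} l ∧
    Module.End.HasEigenvector (Matrix.toLin' (restrictedMatrix V)) l v ∧
    (∀ x, 0 ≤ v x) ∧
    ∀ x, σ x = v x / ∑ z, v z

end

end TorusWalk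

/-! Killing the walk on `B` turns its law at time t into the kernel exp(-t(1 - M)), with M the
symmetric matrix P^B; the conditional law is a row of this kernel divided by the sum of the row.
Normalizing removes the top eigenvalue, so two things matter: its distance to the other eigenvalues,
and how small the survival probability can be from a bad starting point.

A point lies outside `B` exactly when one of its coordinates lies in a fixed arc of the cycle. The
complement is thus a union of d slabs, any two of which meet, so M is irreducible and
Perron–Frobenius yields σ (`existsUnique_isQuasistationary`).

The spectral gap comes from two elementary estimates. A function of zero sum, extended by zero,
obeys the Poincaré inequality on the whole torus, so its Rayleigh quotient is at most c = 1 -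
6/(dN²) (`restrictedMatrix_quadratic_le`). The span of two eigenvectors contains such a function,
hence only one eigenvalue can exceed c. On the other side, a sine in one coordinate, supported on a
slab, is a subsolution with factor m = 1 - (1 - cos(π/(N-2r)))/d, which is about 1 - π²/(2dN²)
(`le_restrictedMatrix_mulVec_arcSine`). It bounds from below both the top eigenvalue and, through
the slab that contains the starting point, the survival probability. No pointwise information on σ
is needed.

Since π²/2 < 6 and r = o(N), m - c is at least 1/(2dN²) for large N. Then `abs_kernel_div_sub_le`
bounds the error by N^(d+1) exp(-t/(2dN²)), and at t = (N log N)² the exponential absorbs the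
polynomial factor. For each of the finitely many remaining N the error is strictly below 1, which is
enough after shrinking the constant. -/

namespace TorusWalk

/-! ### Spectral theorem and Perron–Frobenius for real symmetric matrices -/

section Spectral

open Matrix

variable {ι : Type*} [Fintype ι]

/-- A real symmetric matrix has a complete orthonormal system of eigenvectors. -/
lemma exists_eigensystem [DecidableEq ι] {M : Matrix ι ι ℝ} (hM : M.IsHermitian) :
    ∃ (u : ι → ι → ℝ) (e : ι → ℝ), (∀ k, M *ᵥ u k = e k • u k) ∧
      (∀ k j, u k ⬝ᵥ u j = if k = j then 1 else 0) ∧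
      (∀ x y, ∑ k, u k x * u k y = if x = y then 1 else 0) := by
  refine ⟨fun k => ⇑(hM.eigenvectorBasis k), hM.eigenvalues, hM.mulVec_eigenvectorBasis, ?_, ?_⟩
  · intro k j
    have h := orthonormal_iff_ite.mp hM.eigenvectorBasis.orthonormal k j
    rw [← h, PiLp.inner_apply]
    simp [dotProduct, mul_comm]
  · intro x y
    have h := Unitary.coe_mul_star_self hM.eigenvectorUnitary
    have h2 := congrFun (congrFun h x) y
    rw [Matrix.mul_apply, Matrix.one_apply] at h2
    rw [← h2]
    refine Finset.sum_congr rfl fun k _ => ?_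
    simp [Matrix.star_apply]

lemma dotProduct_mulVec_comm {M : Matrix ι ι ℝ} (hM : M.IsSymm) (f g : ι → ℝ) :
    f ⬝ᵥ (M *ᵥ g) = (M *ᵥ f) ⬝ᵥ g := by
  rw [dotProduct_mulVec, ← mulVec_transpose, hM.eq]

/-- Expansion of a vector in an eigensystem. -/
lemma eq_sum_eigensystem [DecidableEq ι] {u : ι → ι → ℝ}
    (hc : ∀ x y, ∑ k, u k x * u k y = if x = y then 1 else 0) (f : ι → ℝ) (x : ι) :
    f x = ∑ k, (u k ⬝ᵥ f) * u k x := by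
  simp only [dotProduct, Finset.sum_mul]
  rw [Finset.sum_comm]
  have : ∀ y, ∑ k, u k y * f y * u k x = f y * (if y = x then 1 else 0) := by
    intro y
    rw [← hc y x, Finset.mul_sum]
    exact Finset.sum_congr rfl fun k _ => by ring
  simp [this]

lemma dotProduct_self_eq_sum [DecidableEq ι] {u : ι → ι → ℝ}
    (hc : ∀ x y, ∑ k, u k x * u k y = if x = y then 1 else 0) (f : ι → ℝ) :
    f ⬝ᵥ f = ∑ k, (u k ⬝ᵥ f) ^ 2 := by
  calc f ⬝ᵥ f = ∑ x, f x * ∑ k, (u k ⬝ᵥ f) * u k x :=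
        Finset.sum_congr rfl fun x _ => by rw [← eq_sum_eigensystem hc f x]
    _ = ∑ k, ∑ x, f x * ((u k ⬝ᵥ f) * u k x) := by
        simp only [Finset.mul_sum]; rw [Finset.sum_comm]
    _ = _ := by
        refine Finset.sum_congr rfl fun k _ => ?_
        rw [sq]; nth_rewrite 3 [dotProduct]; rw [Finset.mul_sum]
        exact Finset.sum_congr rfl fun x _ => by ring

lemma pow_mulVec_eigenvector [DecidableEq ι] {M : Matrix ι ι ℝ} {l : ℝ} {v : ι → ℝ}
    (h : M *ᵥ v = l • v) (n : ℕ) : (M ^ n) *ᵥ v = l ^ n • v := by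
  induction n with
  | zero => simp
  | succ n ih => rw [pow_succ, ← mulVec_mulVec, h, mulVec_smul, ih, smul_smul, pow_succ, mul_comm]

lemma pow_apply_eq_sum [DecidableEq ι] {M : Matrix ι ι ℝ} {u : ι → ι → ℝ} {e : ι → ℝ}
    (he : ∀ k, M *ᵥ u k = e k • u k)
    (hc : ∀ x y, ∑ k, u k x * u k y = if x = y then 1 else 0) (n : ℕ) (x y : ι) :
    (M ^ n) x y = ∑ k, e k ^ n * (u k x * u k y) := by
  have h1 : (M ^ n) x y = ∑ z, (M ^ n) x z * ∑ k, u k z * u k y := by simp [hc]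
  rw [h1]
  simp only [Finset.mul_sum]
  rw [Finset.sum_comm]
  refine Finset.sum_congr rfl fun k _ => ?_
  have := congrFun (pow_mulVec_eigenvector (he k) n) x
  simp only [mulVec, dotProduct, Pi.smul_apply, smul_eq_mul] at this
  rw [← mul_assoc, ← this, Finset.sum_mul]
  exact Finset.sum_congr rfl fun z _ => by ring

lemma hasEigenvector_toLin'_iff [DecidableEq ι] {M : Matrix ι ι ℝ} {l : ℝ} {v : ι → ℝ} :
    Module.End.HasEigenvector (Matrix.toLin' M) l v ↔ M *ᵥ v = l • v ∧ v ≠ 0 := by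
  rw [Module.End.hasEigenvector_iff, Module.End.mem_eigenspace_iff, Matrix.toLin'_apply]

lemma hasEigenvalue_toLin'_iff [DecidableEq ι] {M : Matrix ι ι ℝ} {l : ℝ} :
    Module.End.HasEigenvalue (Matrix.toLin' M) l ↔ ∃ v : ι → ℝ, M *ᵥ v = l • v ∧ v ≠ 0 := by
  constructor
  · intro h
    obtain ⟨v, hv⟩ := h.exists_hasEigenvector
    exact ⟨v, hasEigenvector_toLin'_iff.mp hv⟩
  · rintro ⟨v, hv⟩
    exact Module.End.hasEigenvalue_of_hasEigenvector (hasEigenvector_toLin'_iff.mpr hv)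

/-! ### Perron–Frobenius for symmetric matrices -/

lemma ne_zero_of_eigensystem [DecidableEq ι] {u : ι → ι → ℝ}
    (ho : ∀ k j, u k ⬝ᵥ u j = if k = j then 1 else 0) (k : ι) : u k ≠ 0 := by
  intro h
  have := ho k k
  simp [h] at this

/-- Any eigenvector has a nonzero coefficient on some `u j`, and symmetry then forces its eigenvalue
to be `e j`. So the finite family `e` exhausts the spectrum. -/
lemma exists_isGreatest_eigenvalue [DecidableEq ι] [Nonempty ι] {M : Matrix ι ι ℝ}
    {u : ι → ι → ℝ} {e : ι → ℝ} (hM : M.IsSymm) (he : ∀ k, M *ᵥ u k = e k • u k)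
    (ho : ∀ k j, u k ⬝ᵥ u j = if k = j then 1 else 0)
    (hc : ∀ x y, ∑ k, u k x * u k y = if x = y then 1 else 0) :
    ∃ k, IsGreatest {m : ℝ | Module.End.HasEigenvalue (Matrix.toLin' M) m} (e k) := by
  obtain ⟨k, hk⟩ := Finite.exists_max e
  refine ⟨k, hasEigenvalue_toLin'_iff.mpr ⟨u k, he k, ne_zero_of_eigensystem ho k⟩, ?_⟩
  intro m hm
  obtain ⟨v, hv, hv0⟩ := hasEigenvalue_toLin'_iff.mp hm
  have : ∃ j, u j ⬝ᵥ v ≠ 0 := by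
    by_contra! h
    exact hv0 (funext fun x => by rw [eq_sum_eigensystem hc v x]; simp [h])
  obtain ⟨j, hj⟩ := this
  have h1 : m * (u j ⬝ᵥ v) = e j * (u j ⬝ᵥ v) := by
    rw [← smul_eq_mul, ← dotProduct_smul, ← hv, dotProduct_mulVec_comm hM, he,
      smul_dotProduct, smul_eq_mul]
  rw [mul_right_cancel₀ hj h1]
  exact hk j

lemma dotProduct_mulVec_le_of_eigenvalues_le [DecidableEq ι] {M : Matrix ι ι ℝ}
    {u : ι → ι → ℝ} {e : ι → ℝ} (hM : M.IsSymm) (he : ∀ k, M *ᵥ u k = e k • u k)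
    (hc : ∀ x y, ∑ k, u k x * u k y = if x = y then 1 else 0)
    {l : ℝ} (hl : ∀ k, e k ≤ l) (f : ι → ℝ) : f ⬝ᵥ (M *ᵥ f) ≤ l * (f ⬝ᵥ f) := by
  have h1 : f ⬝ᵥ (M *ᵥ f) = ∑ k, e k * (u k ⬝ᵥ f) ^ 2 := by
    calc f ⬝ᵥ (M *ᵥ f) = ∑ x, (∑ k, (u k ⬝ᵥ f) * u k x) * (M *ᵥ f) x :=
          Finset.sum_congr rfl fun x _ => by rw [← eq_sum_eigensystem hc f x]
      _ = ∑ k, (u k ⬝ᵥ f) * (u k ⬝ᵥ (M *ᵥ f)) := by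
          simp only [Finset.sum_mul]
          rw [Finset.sum_comm]
          refine Finset.sum_congr rfl fun k _ => ?_
          nth_rewrite 3 [dotProduct]
          rw [Finset.mul_sum]
          exact Finset.sum_congr rfl fun x _ => by ring
      _ = _ := Finset.sum_congr rfl fun k _ => by
          rw [dotProduct_mulVec_comm hM, he, smul_dotProduct, smul_eq_mul]; ring
  rw [h1, dotProduct_self_eq_sum hc f, Finset.mul_sum]
  exact Finset.sum_le_sum fun k _ => mul_le_mul_of_nonneg_right (hl k) (sq_nonneg _)

/-- A vector that attains the maximum of the Rayleigh quotient is an eigenvector. -/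
lemma mulVec_eq_of_rayleigh_max {M : Matrix ι ι ℝ} (hM : M.IsSymm) {l : ℝ}
    (hle : ∀ f : ι → ℝ, f ⬝ᵥ (M *ᵥ f) ≤ l * (f ⬝ᵥ f)) {g : ι → ℝ}
    (hg : l * (g ⬝ᵥ g) ≤ g ⬝ᵥ (M *ᵥ g)) : M *ᵥ g = l • g := by
  classical
  have hS : (l • (1 : Matrix ι ι ℝ) - M).PosSemidef := by
    refine Matrix.PosSemidef.of_dotProduct_mulVec_nonneg ?_ fun f => ?_
    · rw [Matrix.IsHermitian, conjTranspose_eq_transpose_of_trivial, transpose_sub,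
        transpose_smul, transpose_one, hM.eq]
    · rw [sub_mulVec, smul_mulVec, one_mulVec, dotProduct_sub, dotProduct_smul, star_trivial,
        smul_eq_mul]
      linarith [hle f]
  have h0 : star g ⬝ᵥ ((l • (1 : Matrix ι ι ℝ) - M) *ᵥ g) = 0 := by
    rw [sub_mulVec, smul_mulVec, one_mulVec, dotProduct_sub, dotProduct_smul, star_trivial,
      smul_eq_mul]
    linarith [hle g]
  have := (hS.dotProduct_mulVec_zero_iff g).mp h0
  rw [sub_mulVec, smul_mulVec, one_mulVec, sub_eq_zero] at this
  exact this.symm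

/-- Taking absolute values in a top eigenvector keeps its norm and, the entries of `M` being
nonnegative, does not decrease the quadratic form. The result still maximizes the Rayleigh quotient,
hence is an eigenvector. -/
lemma exists_nonneg_eigenvector [DecidableEq ι] [Nonempty ι] {M : Matrix ι ι ℝ} (hM : M.IsSymm)
    (hnn : ∀ i j, 0 ≤ M i j) :
    ∃ (l : ℝ) (v : ι → ℝ),
      IsGreatest {m : ℝ | Module.End.HasEigenvalue (Matrix.toLin' M) m} l ∧
      M *ᵥ v = l • v ∧ v ≠ 0 ∧ ∀ x, 0 ≤ v x := by
  have hH : M.IsHermitian := by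
    rw [Matrix.IsHermitian, conjTranspose_eq_transpose_of_trivial]; exact hM
  obtain ⟨u, e, he, ho, hc⟩ := exists_eigensystem hH
  obtain ⟨k, hk⟩ := exists_isGreatest_eigenvalue hM he ho hc
  have hle : ∀ j, e j ≤ e k := fun j =>
    hk.2 (hasEigenvalue_toLin'_iff.mpr ⟨u j, he j, ne_zero_of_eigensystem ho j⟩)
  refine ⟨e k, fun x => |u k x|, hk, ?_, ?_, fun x => abs_nonneg _⟩
  · refine mulVec_eq_of_rayleigh_max hM (dotProduct_mulVec_le_of_eigenvalues_le hM he hc hle) ?_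
    have h1 : (fun x => |u k x|) ⬝ᵥ (fun x => |u k x|) = u k ⬝ᵥ u k := by
      simp [dotProduct]
    have h2 : e k * (u k ⬝ᵥ u k) = u k ⬝ᵥ (M *ᵥ u k) := by
      rw [he, dotProduct_smul, smul_eq_mul]
    rw [h1, h2]
    simp only [dotProduct, mulVec, Finset.mul_sum]
    refine Finset.sum_le_sum fun x _ => Finset.sum_le_sum fun y _ => ?_
    calc u k x * (M x y * u k y) ≤ |u k x * (M x y * u k y)| := le_abs_self _
      _ = |u k x| * (M x y * |u k y|) := by rw [abs_mul, abs_mul, abs_of_nonneg (hnn x y)]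
  · intro h
    refine ne_zero_of_eigensystem ho k (funext fun x => ?_)
    simpa using congrFun h x

lemma pow_apply_nonneg [DecidableEq ι] {M : Matrix ι ι ℝ} (hnn : ∀ i j, 0 ≤ M i j) (n : ℕ) :
    ∀ i j, 0 ≤ (M ^ n) i j := by
  induction n with
  | zero => intro i j; rw [pow_zero, Matrix.one_apply]; split_ifs <;> norm_num
  | succ n ih =>
    intro i j
    rw [pow_succ, Matrix.mul_apply]
    exact Finset.sum_nonneg fun k _ => mul_nonneg (ih i k) (hnn k j)

lemma pos_of_nonneg_eigenvector [DecidableEq ι] {M : Matrix ι ι ℝ} (hnn : ∀ i j, 0 ≤ M i j)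
    (hirr : ∀ i j, ∃ n, 0 < (M ^ n) i j) {l : ℝ} {v : ι → ℝ} (hv : M *ᵥ v = l • v)
    (hv0 : v ≠ 0) (hvn : ∀ x, 0 ≤ v x) (x : ι) : 0 < v x := by
  obtain ⟨y, hy⟩ : ∃ y, v y ≠ 0 := by
    by_contra! h
    exact hv0 (funext h)
  obtain ⟨n, hn⟩ := hirr x y
  have h1 := congrFun (pow_mulVec_eigenvector hv n) x
  have h2 : 0 < ((M ^ n) *ᵥ v) x := by
    rw [mulVec, dotProduct]
    exact Finset.sum_pos' (fun z _ => mul_nonneg (pow_apply_nonneg hnn n x z) (hvn z))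
      ⟨y, Finset.mem_univ _, mul_pos hn (lt_of_le_of_ne (hvn y) hy.symm)⟩
  rw [h1, Pi.smul_apply, smul_eq_mul] at h2
  refine lt_of_le_of_ne (hvn x) fun h => ?_
  rw [← h, mul_zero] at h2
  exact lt_irrefl _ h2

/-- Subtract from `v` the largest multiple of `w` that leaves a nonnegative vector. The difference
vanishes where `v / w` is minimal, so it cannot be a nonzero nonnegative eigenvector, as that would
be positive everywhere. -/
lemma eigenvector_normalized_unique [DecidableEq ι] {M : Matrix ι ι ℝ} (hnn : ∀ i j, 0 ≤ M i j)
    (hirr : ∀ i j, ∃ n, 0 < (M ^ n) i j) {l : ℝ} {v w : ι → ℝ} (hv : M *ᵥ v = l • v)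
    (hw : M *ᵥ w = l • w) (hvp : ∀ x, 0 < v x) (hwp : ∀ x, 0 < w x) (x : ι) :
    v x / ∑ z, v z = w x / ∑ z, w z := by
  have : Nonempty ι := ⟨x⟩
  obtain ⟨y, hy⟩ := Finite.exists_min fun z => v z / w z
  have hz : M *ᵥ (v - (v y / w y) • w) = l • (v - (v y / w y) • w) := by
    rw [mulVec_sub, mulVec_smul, hv, hw, smul_sub, smul_comm]
  have hnn' : ∀ z, 0 ≤ (v - (v y / w y) • w) z := fun z => by
    have := (le_div_iff₀ (hwp z)).mp (hy z)
    simp only [Pi.sub_apply, Pi.smul_apply, smul_eq_mul]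
    linarith
  have h0 : v - (v y / w y) • w = 0 := by
    by_contra h
    have := pos_of_nonneg_eigenvector hnn hirr hz h hnn' y
    simp [div_mul_cancel₀ _ (hwp y).ne'] at this
  have hvw : ∀ z, v z = (v y / w y) * w z := fun z => by
    have := congrFun h0 z
    simp only [Pi.sub_apply, Pi.smul_apply, smul_eq_mul, Pi.zero_apply] at this
    linarith
  have hc : v y / w y ≠ 0 := (div_pos (hvp y) (hwp y)).ne'
  generalize v y / w y = c at hvw hc
  simp only [hvw, ← Finset.mul_sum]
  rw [mul_div_mul_left _ _ hc]

end Spectral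

/-! ### The Poissonized kernel exp(-t(1 - M)) and its spectral comparison -/

section Poissonized

open Matrix

/-- The probability that a Poisson variable of mean `t` equals `n`. -/
noncomputable def poissonWeight (t : ℝ) (n : ℕ) : ℝ := Real.exp (-t) * (t ^ n / n.factorial)

lemma poissonWeight_nonneg {t : ℝ} (ht : 0 ≤ t) (n : ℕ) : 0 ≤ poissonWeight t n := by
  unfold poissonWeight; positivity

lemma poissonWeight_pos {t : ℝ} (ht : 0 < t) (n : ℕ) : 0 < poissonWeight t n := by
  unfold poissonWeight; positivity

lemma hasSum_poissonWeight_mul_pow (t m : ℝ) :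
    HasSum (fun n => poissonWeight t n * m ^ n) (Real.exp (-t * (1 - m))) := by
  have h := (NormedSpace.expSeries_div_hasSum_exp (𝔸 := ℝ) (t * m)).mul_left (Real.exp (-t))
  rw [← Real.exp_eq_exp_ℝ, ← Real.exp_add] at h
  have h1 : -t * (1 - m) = -t + t * m := by ring
  have h2 : (fun n => poissonWeight t n * m ^ n) =
      fun n : ℕ => Real.exp (-t) * ((t * m) ^ n / n.factorial) := by
    funext n
    rw [poissonWeight, mul_pow]; ring
  rw [h1, h2]
  exact h

variable {ι : Type*} [Fintype ι] [DecidableEq ι]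

lemma hasSum_poissonWeight_mul_matrix_pow {M : Matrix ι ι ℝ} {u : ι → ι → ℝ} {e : ι → ℝ}
    (he : ∀ k, M *ᵥ u k = e k • u k)
    (hc : ∀ x y, ∑ k, u k x * u k y = if x = y then 1 else 0) (t : ℝ) (x y : ι) :
    HasSum (fun n => poissonWeight t n * (M ^ n) x y)
      (∑ k, Real.exp (-t * (1 - e k)) * (u k x * u k y)) := by
  have h : HasSum (fun n => ∑ k, poissonWeight t n * e k ^ n * (u k x * u k y))
      (∑ k, Real.exp (-t * (1 - e k)) * (u k x * u k y)) :=
    hasSum_sum fun k _ => (hasSum_poissonWeight_mul_pow t (e k)).mul_right _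
  convert h using 2 with n
  rw [pow_apply_eq_sum he hc, Finset.mul_sum]
  exact Finset.sum_congr rfl fun k _ => by ring

/-- If the quadratic form of `M` is at most `c` on vectors of zero sum, then at most one eigenvalue
exceeds `c`. -/
lemma eigenvalue_le_of_sum_zero {M : Matrix ι ι ℝ} {u : ι → ι → ℝ} {e : ι → ℝ}
    (he : ∀ k, M *ᵥ u k = e k • u k)
    (ho : ∀ k j, u k ⬝ᵥ u j = if k = j then 1 else 0) {c : ℝ}
    (hgap : ∀ g : ι → ℝ, ∑ x, g x = 0 → g ⬝ᵥ (M *ᵥ g) ≤ c * (g ⬝ᵥ g))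
    {k j : ι} (hkj : k ≠ j) (hle : e k ≤ e j) : e k ≤ c := by
  have h11 : u k ⬝ᵥ u k = 1 := by simp [ho]
  have h22 : u j ⬝ᵥ u j = 1 := by simp [ho]
  have h12 : u k ⬝ᵥ u j = 0 := by simp [ho, hkj]
  have h21 : u j ⬝ᵥ u k = 0 := by simp [ho, hkj.symm]
  -- A zero-sum vector in the span of `u k` and `u j` has Rayleigh quotient at most `c` by `hgap`,
  -- and at least the smaller eigenvalue `e k`.
  have key : ∀ a b : ℝ, a * ∑ x, u k x = b * ∑ x, u j x → 0 < a ^ 2 + b ^ 2 → e k ≤ c := by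
    intro a b hab hpos
    have h := hgap (a • u k - b • u j) (by
      simp only [Pi.sub_apply, Pi.smul_apply, smul_eq_mul, Finset.sum_sub_distrib,
        ← Finset.mul_sum]
      linarith)
    simp only [mulVec_sub, mulVec_smul, he, sub_dotProduct, dotProduct_sub, smul_dotProduct,
      dotProduct_smul, h11, h22, h12, h21, smul_eq_mul] at h
    have h2 : e k * (a ^ 2 + b ^ 2) ≤ c * (a ^ 2 + b ^ 2) := by
      nlinarith [mul_nonneg (sub_nonneg.mpr hle) (sq_nonneg b)]
    exact le_of_mul_le_mul_right h2 hpos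
  by_cases h : ∑ x, u k x = 0
  · exact key 1 0 (by rw [h]; ring) (by norm_num)
  · exact key (∑ x, u j x) (∑ x, u k x) (mul_comm _ _) (by positivity)

/-- Each row of an orthogonal matrix has norm 1, so AM-GM on the products suffices and no factor of
the dimension appears. -/
lemma abs_sum_eigensystem_le {u : ι → ι → ℝ} {b : ι → ℝ}
    (hc : ∀ x y, ∑ k, u k x * u k y = if x = y then 1 else 0) {r : ℝ}
    (hb : ∀ k, |b k| ≤ r) (x y : ι) :
    |∑ k, b k * (u k x * u k y)| ≤ r := by
  have h1 : ∀ x, ∑ k, u k x ^ 2 = 1 := fun x => by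
    have := hc x x
    simpa [sq] using this
  calc |∑ k, b k * (u k x * u k y)| ≤ ∑ k, |b k * (u k x * u k y)| :=
        Finset.abs_sum_le_sum_abs _ _
    _ ≤ ∑ k, r * ((u k x ^ 2 + u k y ^ 2) / 2) := by
        refine Finset.sum_le_sum fun k _ => ?_
        rw [abs_mul]
        refine mul_le_mul (hb k) ?_ (abs_nonneg _) ((abs_nonneg _).trans (hb k))
        rw [abs_mul]
        nlinarith [sq_nonneg (|u k x| - |u k y|), sq_abs (u k x), sq_abs (u k y)]
    _ = r := by
        rw [← Finset.mul_sum, ← Finset.sum_div, Finset.sum_add_distrib, h1, h1]; ring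

lemma pow_smul_le_pow_mulVec {M : Matrix ι ι ℝ} (hnn : ∀ i j, 0 ≤ M i j) {m : ℝ} (hm : 0 ≤ m)
    {f : ι → ℝ} (hf : ∀ x, m * f x ≤ (M *ᵥ f) x) (n : ℕ) :
    ∀ x, m ^ n * f x ≤ ((M ^ n) *ᵥ f) x := by
  induction n with
  | zero => simp
  | succ n ih =>
    intro x
    calc m ^ (n + 1) * f x = m ^ n * (m * f x) := by ring
      _ ≤ m ^ n * (M *ᵥ f) x := mul_le_mul_of_nonneg_left (hf x) (pow_nonneg hm n)
      _ = ∑ y, M x y * (m ^ n * f y) := by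
        rw [mulVec, dotProduct, Finset.mul_sum]
        exact Finset.sum_congr rfl fun y _ => by ring
      _ ≤ ∑ y, M x y * ((M ^ n) *ᵥ f) y :=
        Finset.sum_le_sum fun y _ => mul_le_mul_of_nonneg_left (ih y) (hnn x y)
      _ = _ := by rw [pow_succ', ← mulVec_mulVec]; rfl

/-- This is the lower bound for the survival probability: iterating the subsolution gives `m ^ n * f
x` after `n` steps, and `f ≤ 1` lets the total mass dominate. Averaging over the Poisson number of
steps gives the exponential. -/
lemma exp_mul_le_sum_kernel {M : Matrix ι ι ℝ} (hnn : ∀ i j, 0 ≤ M i j) {m : ℝ} (hm : 0 ≤ m)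
    {f : ι → ℝ} (hf : ∀ x, m * f x ≤ (M *ᵥ f) x) (hf1 : ∀ x, f x ≤ 1) {t : ℝ} (ht : 0 ≤ t)
    {x : ι} {K : ι → ℝ} (hK : ∀ y, HasSum (fun n => poissonWeight t n * (M ^ n) x y) (K y)) :
    Real.exp (-t * (1 - m)) * f x ≤ ∑ y, K y := by
  have h1 := (hasSum_poissonWeight_mul_pow t m).mul_right (f x)
  have h2 : HasSum (fun n => ∑ y, poissonWeight t n * (M ^ n) x y) (∑ y, K y) :=
    hasSum_sum fun y _ => hK y
  refine hasSum_le (fun n => ?_) h1 h2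
  rw [mul_assoc, ← Finset.mul_sum]
  refine mul_le_mul_of_nonneg_left ?_ (poissonWeight_nonneg ht n)
  refine (pow_smul_le_pow_mulVec hnn hm hf n x).trans ?_
  rw [mulVec, dotProduct]
  exact Finset.sum_le_sum fun y _ => mul_le_of_le_one_right (pow_apply_nonneg hnn n x y) (hf1 y)

/-- Comparison of the normalized kernel with the normalized Perron eigenvector `w`, in terms of a
bound `c` for the quadratic form on vectors of zero sum and of a positive subsolution `f`. -/
lemma abs_kernel_div_sub_le {M : Matrix ι ι ℝ} (hM : M.IsSymm) (hnn : ∀ i j, 0 ≤ M i j)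
    {l : ℝ} {w : ι → ℝ}
    (hl : IsGreatest {m : ℝ | Module.End.HasEigenvalue (Matrix.toLin' M) m} l)
    (hw : M *ᵥ w = l • w) (hwp : ∀ x, 0 < w x) {c : ℝ}
    (hgap : ∀ g : ι → ℝ, ∑ x, g x = 0 → g ⬝ᵥ (M *ᵥ g) ≤ c * (g ⬝ᵥ g))
    {m : ℝ} (hm : 0 ≤ m) (hcm : c < m) {f : ι → ℝ} (hf0 : ∀ x, 0 ≤ f x) (hf1 : ∀ x, f x ≤ 1)
    (hf : ∀ x, m * f x ≤ (M *ᵥ f) x) {t : ℝ} (ht : 0 ≤ t)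
    {x : ι} (hfx : 0 < f x) {K : ι → ℝ}
    (hK : ∀ y, HasSum (fun n => poissonWeight t n * (M ^ n) x y) (K y)) (y : ι) :
    |K y / ∑ z, K z - w y / ∑ z, w z| ≤
      (1 + Fintype.card ι) * Real.exp (-t * (m - c)) / f x := by
  have hne : Nonempty ι := ⟨x⟩
  have hH : M.IsHermitian := by
    rw [Matrix.IsHermitian, conjTranspose_eq_transpose_of_trivial]; exact hM
  obtain ⟨u, e, he, ho, hc⟩ := exists_eigensystem hH
  obtain ⟨k₀, hk₀⟩ := exists_isGreatest_eigenvalue hM he ho hc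
  have hlk : e k₀ = l := hk₀.unique hl
  have hS : 0 < ∑ z, w z := Finset.sum_pos (fun z _ => hwp z) Finset.univ_nonempty
  -- Pair the subsolution with the positive eigenvector `w`.
  have hml : m ≤ l := by
    have h1 : m * (w ⬝ᵥ f) ≤ l * (w ⬝ᵥ f) := by
      calc m * (w ⬝ᵥ f) = ∑ z, w z * (m * f z) := by
            rw [dotProduct, Finset.mul_sum]; exact Finset.sum_congr rfl fun z _ => by ring
        _ ≤ ∑ z, w z * (M *ᵥ f) z :=
            Finset.sum_le_sum fun z _ => mul_le_mul_of_nonneg_left (hf z) (hwp z).le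
        _ = w ⬝ᵥ (M *ᵥ f) := rfl
        _ = l * (w ⬝ᵥ f) := by
            rw [dotProduct_mulVec_comm hM, hw, smul_dotProduct, smul_eq_mul]
    refine le_of_mul_le_mul_right h1 ?_
    rw [dotProduct]
    exact Finset.sum_pos' (fun z _ => mul_nonneg (hwp z).le (hf0 z))
      ⟨x, Finset.mem_univ _, mul_pos (hwp x) hfx⟩
  have hother : ∀ k, k ≠ k₀ → e k ≤ c := fun k hk =>
    eigenvalue_le_of_sum_zero he ho hgap hk
      (hk₀.2 (hasEigenvalue_toLin'_iff.mpr ⟨u k, he k, ne_zero_of_eigensystem ho k⟩))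
  -- The eigenvalue of `w` is `l ≥ m > c`, whereas `e k ≤ c` for all `k ≠ k₀`; so `w` is a multiple
  -- of `u k₀`.
  have horth : ∀ k, k ≠ k₀ → u k ⬝ᵥ w = 0 := by
    intro k hk
    have h1 : l * (u k ⬝ᵥ w) = e k * (u k ⬝ᵥ w) := by
      rw [← smul_eq_mul, ← dotProduct_smul, ← hw, dotProduct_mulVec_comm hM, he,
        smul_dotProduct, smul_eq_mul]
    by_contra h
    have := mul_right_cancel₀ h h1
    linarith [hother k hk]
  have hwu : ∀ z, w z = (u k₀ ⬝ᵥ w) * u k₀ z := fun z => by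
    rw [eq_sum_eigensystem hc w z, Finset.sum_eq_single k₀]
    · intro k _ hk; rw [horth k hk, zero_mul]
    · intro h; exact absurd (Finset.mem_univ _) h
  have ha : u k₀ ⬝ᵥ w ≠ 0 := by
    intro h
    have := hwu x
    rw [h, zero_mul] at this
    exact (hwp x).ne' this
  set a := u k₀ ⬝ᵥ w with ha_def
  set b : ι → ℝ := fun k => if k = k₀ then 0 else Real.exp (-t * (1 - e k)) with hb_def
  set R : ι → ℝ := fun z => ∑ k, b k * (u k x * u k z) with hR_def
  have hR : ∀ z, |R z| ≤ Real.exp (-t * (1 - c)) := by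
    intro z
    refine abs_sum_eigensystem_le hc (fun k => ?_) x z
    simp only [hb_def]
    split_ifs with h
    · rw [abs_zero]; exact (Real.exp_pos _).le
    · rw [abs_of_pos (Real.exp_pos _), Real.exp_le_exp]
      nlinarith [mul_nonneg ht (sub_nonneg.mpr (hother k h))]
  set q : ℝ := Real.exp (-t * (1 - e k₀)) * (w x / a ^ 2) with hq_def
  have hKR : ∀ z, K z = q * w z + R z := by
    intro z
    rw [(hK z).unique (hasSum_poissonWeight_mul_matrix_pow he hc t x z)]
    rw [← Finset.add_sum_erase _ _ (Finset.mem_univ k₀)]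
    congr 1
    · rw [hq_def, hwu x, hwu z]; field_simp
    · rw [hR_def]
      simp only
      rw [← Finset.add_sum_erase (s := Finset.univ) (a := k₀) (h := Finset.mem_univ k₀)]
      simp only [hb_def, if_true, zero_mul, zero_add]
      refine Finset.sum_congr rfl fun k hk => ?_
      rw [if_neg (Finset.ne_of_mem_erase hk)]
  have hZ := exp_mul_le_sum_kernel hnn hm hf hf1 ht hK
  have hZ0 : 0 < Real.exp (-t * (1 - m)) * f x := mul_pos (Real.exp_pos _) hfx
  have hZpos : 0 < ∑ z, K z := hZ0.trans_le hZ
  have hsum : ∑ z, K z = q * ∑ z, w z + ∑ z, R z := by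
    simp only [hKR, Finset.sum_add_distrib, Finset.mul_sum]
  have hnum : |R y - w y / (∑ z, w z) * ∑ z, R z| ≤
      (1 + Fintype.card ι) * Real.exp (-t * (1 - c)) := by
    have h1 : |∑ z, R z| ≤ Fintype.card ι * Real.exp (-t * (1 - c)) := by
      refine (Finset.abs_sum_le_sum_abs _ _).trans ?_
      refine (Finset.sum_le_sum fun z _ => hR z).trans ?_
      simp
    have h2 : |w y / ∑ z, w z| ≤ 1 := by
      rw [abs_of_pos (div_pos (hwp y) hS), div_le_one hS]
      exact Finset.single_le_sum (fun z _ => (hwp z).le) (Finset.mem_univ y)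
    calc |R y - w y / (∑ z, w z) * ∑ z, R z| ≤ |R y| + |w y / (∑ z, w z) * ∑ z, R z| :=
          abs_sub _ _
      _ ≤ Real.exp (-t * (1 - c)) + 1 * (Fintype.card ι * Real.exp (-t * (1 - c))) := by
          rw [abs_mul]
          exact add_le_add (hR y) (mul_le_mul h2 h1 (abs_nonneg _) zero_le_one)
      _ = _ := by ring
  -- The multiple `q * w` of the Perron vector cancels, and only the remainders `R` survive in the
  -- numerator.
  have heq : K y / ∑ z, K z - w y / ∑ z, w z =
      (R y - w y / (∑ z, w z) * ∑ z, R z) / ∑ z, K z := by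
    rw [eq_div_iff hZpos.ne', sub_mul, div_mul_cancel₀ _ hZpos.ne', hsum, hKR y]
    field_simp
    ring
  rw [heq, abs_div, abs_of_pos hZpos]
  calc |R y - w y / (∑ z, w z) * ∑ z, R z| / ∑ z, K z
      ≤ (1 + Fintype.card ι) * Real.exp (-t * (1 - c)) / (Real.exp (-t * (1 - m)) * f x) :=
        div_le_div₀ (by positivity) hnum hZ0 hZ
    _ = _ := by
        have : Real.exp (-t * (1 - c)) = Real.exp (-t * (m - c)) * Real.exp (-t * (1 - m)) := by
          rw [← Real.exp_add]; congr 1; ring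
        rw [this]
        field_simp

/-- For an irreducible matrix the kernel is positive at positive times. -/
lemma kernel_pos {M : Matrix ι ι ℝ} (hnn : ∀ i j, 0 ≤ M i j) {x y : ι}
    (hirr : ∃ n, 0 < (M ^ n) x y) {t : ℝ} (ht : 0 < t) {k : ℝ}
    (hK : HasSum (fun n => poissonWeight t n * (M ^ n) x y) k) : 0 < k := by
  obtain ⟨n, hn⟩ := hirr
  have h0 : ∀ n, 0 ≤ poissonWeight t n * (M ^ n) x y := fun n =>
    mul_nonneg (poissonWeight_nonneg ht.le n) (pow_apply_nonneg hnn n x y)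
  exact (mul_pos (poissonWeight_pos ht n) hn).trans_le (le_hasSum hK n fun j _ => h0 j)

end Poissonized

/-! ### Poincaré inequalities on the cycle and on the torus -/

section Poincare

variable {N : ℕ} [NeZero N]

lemma sum_range_natCast_zmod (F : ZMod N → ℝ) :
    ∑ h ∈ Finset.range N, F (h : ZMod N) = ∑ b, F b := by
  refine Finset.sum_nbij' (fun h => (h : ZMod N)) ZMod.val ?_ ?_ ?_ ?_ ?_
  · simp
  · intro a _; simpa using ZMod.val_lt a
  · intro h hh; exact ZMod.val_cast_of_lt (Finset.mem_range.mp hh)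
  · intro a _; simp
  · simp

lemma sum_range_mul_sub (N n : ℕ) :
    ∑ h ∈ Finset.range n, (h : ℝ) * (N - h) =
      N * (n * (n - 1) / 2) - n * (n - 1) * (2 * n - 1) / 6 := by
  induction n with
  | zero => simp
  | succ n ih => rw [Finset.sum_range_succ, ih]; push_cast; ring

/-- Telescope the increment into `h` unit steps and apply Cauchy–Schwarz; translation invariance
makes all unit-step sums equal. -/
lemma sum_sq_translate_sub_le (g : ZMod N → ℝ) (h : ℕ) :
    ∑ a, (g (a + h) - g a) ^ 2 ≤ (h : ℝ) ^ 2 * ∑ a, (g (a + 1) - g a) ^ 2 := by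
  have h1 : ∀ a, (g (a + h) - g a) ^ 2 ≤
      h * ∑ j ∈ Finset.range h, (g (a + j + 1) - g (a + j)) ^ 2 := by
    intro a
    have h2 : g (a + h) - g a = ∑ j ∈ Finset.range h, (g (a + j + 1) - g (a + j)) := by
      have := Finset.sum_range_sub (fun j : ℕ => g (a + j)) h
      simp only [Nat.cast_add, Nat.cast_one, Nat.cast_zero, add_zero, ← add_assoc] at this
      exact this.symm
    rw [h2]
    simpa using sq_sum_le_card_mul_sum_sq (s := Finset.range h)
      (f := fun j : ℕ => g (a + j + 1) - g (a + j))
  refine (Finset.sum_le_sum fun a _ => h1 a).trans ?_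
  rw [← Finset.mul_sum, Finset.sum_comm]
  have h3 : ∀ j : ℕ, ∑ a, (g (a + j + 1) - g (a + j)) ^ 2 = ∑ a, (g (a + 1) - g a) ^ 2 := fun j =>
    Equiv.sum_comp (Equiv.addRight (j : ZMod N)) fun a => (g (a + 1) - g a) ^ 2
  simp only [h3, Finset.sum_const, Finset.card_range, nsmul_eq_mul]
  rw [← mul_assoc, sq]

/-- A shift by `h` can also be undone by going on `N - h` steps around the cycle, and the square of
the shorter distance is at most `h * (N - h)`. -/
lemma sum_sq_translate_sub_le_mul (g : ZMod N → ℝ) {h : ℕ} (hh : h ≤ N) :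
    ∑ a, (g (a + h) - g a) ^ 2 ≤ (h * (N - h) : ℝ) * ∑ a, (g (a + 1) - g a) ^ 2 := by
  have hD : 0 ≤ ∑ a, (g (a + 1) - g a) ^ 2 := Finset.sum_nonneg fun a _ => sq_nonneg _
  have hN : (h : ℝ) ≤ N := by exact_mod_cast hh
  have h0 : (0 : ℝ) ≤ h := Nat.cast_nonneg h
  rcases le_total (h : ℝ) (N - h) with hc | hc
  · refine (sum_sq_translate_sub_le g h).trans (mul_le_mul_of_nonneg_right ?_ hD)
    nlinarith
  · have h1 : ∑ a, (g (a + h) - g a) ^ 2 = ∑ a, (g (a + (N - h : ℕ)) - g a) ^ 2 := by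
      rw [← Equiv.sum_comp (Equiv.addRight ((N - h : ℕ) : ZMod N))]
      refine Finset.sum_congr rfl fun a _ => ?_
      have : a + ((N - h : ℕ) : ZMod N) + h = a := by
        rw [add_assoc, ← Nat.cast_add, Nat.sub_add_cancel hh]; simp
      simp only [Equiv.coe_addRight]
      rw [this]; ring
    rw [h1]
    refine (sum_sq_translate_sub_le g (N - h)).trans (mul_le_mul_of_nonneg_right ?_ hD)
    rw [Nat.cast_sub hh]
    nlinarith

/-- Poincaré inequality on the cycle. -/
lemma sum_sq_le_cycle (g : ZMod N → ℝ) :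
    ∑ a, g a ^ 2 ≤ (N : ℝ) ^ 2 / 12 * ∑ a, (g (a + 1) - g a) ^ 2 + (∑ a, g a) ^ 2 / N := by
  have hN : (0 : ℝ) < N := Nat.cast_pos.mpr (NeZero.pos N)
  have hD : 0 ≤ ∑ a, (g (a + 1) - g a) ^ 2 := Finset.sum_nonneg fun a _ => sq_nonneg _
  set D := ∑ a, (g (a + 1) - g a) ^ 2
  -- Summing over all shifts produces the variance on the left (`h2`). On the right the coefficients
  -- add up to N(N²-1)/6, whence the constant N²/12.
  have h1 : ∑ h ∈ Finset.range N, ∑ a, (g (a + (h : ZMod N)) - g a) ^ 2 ≤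
      ∑ h ∈ Finset.range N, (h * (N - h) : ℝ) * D :=
    Finset.sum_le_sum fun h hh => sum_sq_translate_sub_le_mul g (Finset.mem_range.mp hh).le
  rw [← Finset.sum_mul, sum_range_mul_sub,
    sum_range_natCast_zmod fun b => ∑ a, (g (a + b) - g a) ^ 2] at h1
  have h2 : ∑ b, ∑ a, (g (a + b) - g a) ^ 2 = 2 * N * ∑ a, g a ^ 2 - 2 * (∑ a, g a) ^ 2 := by
    rw [Finset.sum_comm]
    have h3 : ∀ a, ∑ b, (g (a + b) - g a) ^ 2 =
        ∑ b, g b ^ 2 + N * g a ^ 2 - 2 * (∑ b, g b) * g a := by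
      intro a
      have h4 := Equiv.sum_comp (Equiv.addLeft a) fun b => (g b - g a) ^ 2
      simp only [Equiv.coe_addLeft] at h4
      rw [h4]
      simp only [sub_sq, Finset.sum_add_distrib, Finset.sum_sub_distrib, Finset.sum_const,
        Finset.card_univ, ZMod.card, nsmul_eq_mul, ← Finset.mul_sum, ← Finset.sum_mul]
      ring
    simp only [h3, Finset.sum_add_distrib, Finset.sum_sub_distrib, Finset.sum_const,
        Finset.card_univ, ZMod.card, nsmul_eq_mul, ← Finset.mul_sum]
    ring
  rw [h2] at h1
  have h4 : (N * (N * (N - 1) / 2) - N * (N - 1) * (2 * N - 1) / 6 : ℝ) * D ≤ N ^ 3 / 6 * D := by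
    refine mul_le_mul_of_nonneg_right ?_ hD
    nlinarith
  have h5 : N * ∑ a, g a ^ 2 ≤ N * (N ^ 2 / 12 * D + (∑ a, g a) ^ 2 / N) := by
    rw [mul_add, mul_div_cancel₀ _ hN.ne']
    nlinarith
  exact le_of_mul_le_mul_left h5 hN

/-- Poincaré inequality on the torus. -/
lemma sum_sq_le_torus (d : ℕ) (f : Torus N d → ℝ) :
    ∑ x, f x ^ 2 ≤ (N : ℝ) ^ 2 / 12 * ∑ i, ∑ x, (f (x + Pi.single i 1) - f x) ^ 2 +
      (∑ x, f x) ^ 2 / N ^ d := by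
  have hN : (0 : ℝ) < N := Nat.cast_pos.mpr (NeZero.pos N)
  induction d with
  | zero => simp
  | succ d ih =>
    have hsplit : ∀ F : Torus N (d + 1) → ℝ, ∑ x, F x = ∑ a, ∑ y : Torus N d, F (Fin.cons a y) := by
      intro F
      rw [← Equiv.sum_comp (Fin.consEquiv fun _ : Fin (d + 1) => ZMod N), Fintype.sum_prod_type]
      rfl
    have hs0 : ∀ (a : ZMod N) (y : Torus N d),
        (Fin.cons a y : Torus N (d + 1)) + Pi.single 0 1 = Fin.cons (a + 1) y := by
      intro a y
      funext j
      refine Fin.cases ?_ (fun j => ?_) j <;> simp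
    have hss : ∀ (a : ZMod N) (y : Torus N d) (i : Fin d),
        (Fin.cons a y : Torus N (d + 1)) + Pi.single i.succ 1 = Fin.cons a (y + Pi.single i 1) := by
      intro a y i
      funext j
      refine Fin.cases ?_ (fun j => ?_) j
      · simp
      · simp [Pi.single_apply]
    rw [hsplit, hsplit, Fin.sum_univ_succ]
    simp only [hsplit fun x => (f (x + Pi.single _ 1) - f x) ^ 2, hs0, hss]
    -- The induction hypothesis on the fibres leaves the fibre sums `G`, which the cycle inequality
    -- controls. Cauchy–Schwarz along a fibre costs a factor `N ^ d`, which the denominator `N ^ d`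
    -- cancels.
    set G : ZMod N → ℝ := fun a => ∑ y : Torus N d, f (Fin.cons a y)
    have h1 : ∑ a, ∑ y : Torus N d, f (Fin.cons a y) ^ 2 ≤
        (N : ℝ) ^ 2 / 12 * ∑ i, ∑ a, ∑ y : Torus N d,
          (f (Fin.cons a (y + Pi.single i 1)) - f (Fin.cons a y)) ^ 2 + (∑ a, G a ^ 2) / N ^ d := by
      refine (Finset.sum_le_sum fun a _ => ih fun y => f (Fin.cons a y)).trans (le_of_eq ?_)
      rw [Finset.sum_add_distrib, ← Finset.mul_sum, ← Finset.sum_div, Finset.sum_comm]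
    have h2 : ∀ a, (G (a + 1) - G a) ^ 2 ≤
        N ^ d * ∑ y : Torus N d, (f (Fin.cons (a + 1) y) - f (Fin.cons a y)) ^ 2 := by
      intro a
      have := sq_sum_le_card_mul_sum_sq (s := Finset.univ)
        (f := fun y : Torus N d => f (Fin.cons (a + 1) y) - f (Fin.cons a y))
      simpa [Finset.sum_sub_distrib, G] using this
    have h3 : (∑ a, G a ^ 2) / N ^ d ≤
        (N : ℝ) ^ 2 / 12 * ∑ a, ∑ y : Torus N d,
          (f (Fin.cons (a + 1) y) - f (Fin.cons a y)) ^ 2 + (∑ a, G a) ^ 2 / N ^ (d + 1) := by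
      rw [div_le_iff₀ (by positivity)]
      refine (sum_sq_le_cycle G).trans ?_
      have h4 : ∑ a, (G (a + 1) - G a) ^ 2 ≤ N ^ d * ∑ a, ∑ y : Torus N d,
          (f (Fin.cons (a + 1) y) - f (Fin.cons a y)) ^ 2 := by
        rw [Finset.mul_sum]; exact Finset.sum_le_sum fun a _ => h2 a
      have h5 := mul_le_mul_of_nonneg_left h4 (by positivity : (0 : ℝ) ≤ (N : ℝ) ^ 2 / 12)
      have h6 : (∑ a, G a) ^ 2 / (N : ℝ) ^ (d + 1) * N ^ d = (∑ a, G a) ^ 2 / N := by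
        field_simp; rw [pow_succ]; ring
      rw [add_mul, h6]
      linarith
    rw [mul_add]
    linarith

end Poincare

/-! ### The restricted matrix: neighbours, quadratic form, irreducibility -/

section Restricted

open Matrix
open scoped Classical

variable {N d : ℕ}

/-- The image in the torus of a lattice step. -/
def torusStep (N : ℕ) {d : ℕ} (s : Fin d × Bool) : Torus N d :=
  Pi.single s.1 (if s.2 then 1 else -1)

lemma intCast_stepVec (s : Fin d × Bool) (i : Fin d) :
    ((stepVec s i : ℤ) : ZMod N) = torusStep N s i := by
  unfold stepVec torusStep
  by_cases h : i = s.1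
  · subst h; cases s.2 <;> simp
  · simp [h]

/-- For N ≥ 3 one has 1 ≠ -1, so the 2d steps reach 2d different neighbours. Only then do the
entries 1/(2d) of the matrix agree with the step law of the walk. -/
lemma torusStep_injective (hN : 3 ≤ N) : Function.Injective (torusStep N (d := d)) := by
  have : Fact (1 < N) := ⟨by omega⟩
  have h2 : (1 : ZMod N) ≠ -1 := by
    have : Fact (2 < N) := ⟨hN⟩
    exact (ZMod.neg_one_ne_one).symm
  have key : ∀ b : Bool, (if b then (1 : ZMod N) else -1) ≠ 0 := by
    intro b; cases b <;> simp
  rintro ⟨i, a⟩ ⟨j, b⟩ h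
  have hij : i = j := by
    by_contra hne
    have := congrFun h i
    simp only [torusStep, Pi.single_eq_same, Pi.single_eq_of_ne hne] at this
    exact key a this
  subst hij
  have := congrFun h i
  simp only [torusStep, Pi.single_eq_same] at this
  cases a <;> cases b <;> simp_all

lemma torusStep_ne_zero (hN : 2 ≤ N) (s : Fin d × Bool) : torusStep N s ≠ 0 := by
  have : Fact (1 < N) := ⟨hN⟩
  intro h
  have := congrFun h s.1
  simp only [torusStep, Pi.single_eq_same, Pi.zero_apply] at this
  revert this
  cases s.2 <;> simp

lemma torusGraph_adj_iff (hN : 2 ≤ N) (x y : Torus N d) :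
    (torusGraph N d).Adj x y ↔ ∃ s, y = x + torusStep N s := by
  rw [torusGraph, SimpleGraph.fromRel_adj]
  constructor
  · rintro ⟨-, ⟨i, rfl⟩ | ⟨i, h⟩⟩
    · exact ⟨(i, true), by simp [torusStep]⟩
    · refine ⟨(i, false), ?_⟩
      rw [h, add_assoc, torusStep, ← Pi.single_add]
      simp
  · rintro ⟨⟨i, b⟩, rfl⟩
    refine ⟨fun h => torusStep_ne_zero hN (i, b) (by simpa using h), ?_⟩
    cases b
    · right
      refine ⟨i, ?_⟩
      rw [add_assoc, torusStep, ← Pi.single_add]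
      simp
    · left
      exact ⟨i, by simp [torusStep]⟩

lemma sum_adj_eq_sum_torusStep [NeZero N] (hN : 3 ≤ N) (x : Torus N d) (F : Torus N d → ℝ) :
    ∑ y, (if (torusGraph N d).Adj x y then F y else 0) = ∑ s, F (x + torusStep N s) := by
  rw [← Finset.sum_filter]
  have h : Finset.univ.filter (fun y => (torusGraph N d).Adj x y) =
      Finset.univ.image fun s => x + torusStep N s := by
    ext y
    simp only [Finset.mem_filter, Finset.mem_univ, true_and, Finset.mem_image,
      torusGraph_adj_iff (by omega : 2 ≤ N)]
    exact exists_congr fun s => eq_comm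
  rw [h, Finset.sum_image]
  intro a _ b _ hab
  exact torusStep_injective hN (add_left_cancel hab)

lemma sum_subtype_eq_sum [NeZero N] {V : Set (Torus N d)} {F : Torus N d → ℝ} (hF : ∀ x ∈ V, F x = 0) :
    ∑ z : {x : Torus N d // x ∉ V}, F z = ∑ x, F x := by
  rw [← Finset.sum_subtype (Finset.univ.filter fun x => x ∉ V) (by simp) F]
  refine Finset.sum_filter_of_ne fun x _ hx hV => hx (hF x hV)

lemma restrictedMatrix_mulVec [NeZero N] (hN : 3 ≤ N) {V : Set (Torus N d)} {F : Torus N d → ℝ}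
    (hF : ∀ x ∈ V, F x = 0) (x : {x : Torus N d // x ∉ V}) :
    (restrictedMatrix V *ᵥ fun z : {x : Torus N d // x ∉ V} => F z) x =
      1 / (2 * (d : ℝ)) * ∑ s, F ((x : Torus N d) + torusStep N s) := by
  rw [← sum_adj_eq_sum_torusStep hN (x : Torus N d) F, mulVec, dotProduct, Finset.mul_sum,
    ← sum_subtype_eq_sum (V := V)]
  · refine Finset.sum_congr rfl fun z _ => ?_
    unfold restrictedMatrix
    split_ifs <;> simp
  · intro y hy
    simp [hF y hy]

lemma sum_torusStep (x : Torus N d) (F : Torus N d → ℝ) :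
    ∑ s, F (x + torusStep N s) =
      ∑ i, (F (x + Pi.single i 1) + F (x - Pi.single i 1)) := by
  rw [Fintype.sum_prod_type]
  refine Finset.sum_congr rfl fun i _ => ?_
  simp [torusStep, sub_eq_add_neg, Pi.single_neg]

lemma restrictedMatrix_isSymm (V : Set (Torus N d)) : (restrictedMatrix V).IsSymm := by
  ext x y
  simp only [Matrix.transpose_apply, restrictedMatrix, SimpleGraph.adj_comm]

lemma restrictedMatrix_nonneg (V : Set (Torus N d)) (x y : {x : Torus N d // x ∉ V}) :
    0 ≤ restrictedMatrix V x y := by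
  unfold restrictedMatrix
  split_ifs <;> positivity

lemma sum_mul_neighbors [NeZero N] (F : Torus N d → ℝ) (i : Fin d) :
    ∑ x, F x * (F (x + Pi.single i 1) + F (x - Pi.single i 1)) =
      2 * ∑ x, F x ^ 2 - ∑ x, (F (x + Pi.single i 1) - F x) ^ 2 := by
  generalize (Pi.single i 1 : Torus N d) = v
  have e1 : ∑ x, F x * F (x - v) = ∑ x, F (x + v) * F x := by
    rw [← Equiv.sum_comp (Equiv.addRight v)]
    simp only [Equiv.coe_addRight, add_sub_cancel_right]
  have e2 : ∑ x, F (x + v) ^ 2 = ∑ x, F x ^ 2 :=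
    Equiv.sum_comp (Equiv.addRight v) fun x => F x ^ 2
  have e3 : ∑ x, (F (x + v) - F x) ^ 2 = ∑ x, F (x + v) ^ 2 -
      2 * ∑ x, F (x + v) * F x + ∑ x, F x ^ 2 := by
    rw [Finset.mul_sum, ← Finset.sum_sub_distrib, ← Finset.sum_add_distrib]
    exact Finset.sum_congr rfl fun x _ => by ring
  have e4 : ∑ x, F x * (F (x + v) + F (x - v)) =
      ∑ x, F (x + v) * F x + ∑ x, F x * F (x - v) := by
    rw [← Finset.sum_add_distrib]
    exact Finset.sum_congr rfl fun x _ => by ring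
  rw [e4, e1, e3, e2]; ring

/-- The quadratic form of the restricted matrix on functions of zero sum. -/
lemma restrictedMatrix_quadratic_le [NeZero N] (hN : 3 ≤ N) (hd : 1 ≤ d) (V : Set (Torus N d))
    (g : {x : Torus N d // x ∉ V} → ℝ) (hg : ∑ x, g x = 0) :
    g ⬝ᵥ (restrictedMatrix V *ᵥ g) ≤ (1 - 6 / (d * (N : ℝ) ^ 2)) * (g ⬝ᵥ g) := by
  -- Extension by zero keeps the sum zero and the quadratic form unchanged, so the Poincaré
  -- inequality of the full torus applies.
  set F : Torus N d → ℝ := fun x => if h : x ∉ V then g ⟨x, h⟩ else 0 with hF_def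
  have hF : ∀ x ∈ V, F x = 0 := fun x hx => by simp [hF_def, hx]
  have hgF : g = fun z : {x : Torus N d // x ∉ V} => F z := by
    funext z
    simp only [hF_def]
    rw [dif_pos z.2]
  have hN0 : (0 : ℝ) < N := by positivity
  have hd0 : (0 : ℝ) < d := by positivity
  have h0 : ∑ x, F x = 0 := by
    rw [← sum_subtype_eq_sum hF, ← hg, hgF]
  have h1 : g ⬝ᵥ g = ∑ x, F x ^ 2 := by
    rw [← sum_subtype_eq_sum (V := V) fun x hx => by rw [hF x hx]; norm_num]
    rw [hgF, dotProduct]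
    exact Finset.sum_congr rfl fun x _ => (sq _).symm
  have h2 : g ⬝ᵥ (restrictedMatrix V *ᵥ g) =
      ∑ x, F x * (1 / (2 * (d : ℝ)) * ∑ s, F (x + torusStep N s)) := by
    rw [← sum_subtype_eq_sum (V := V) fun x hx => by rw [hF x hx, zero_mul]]
    rw [hgF, dotProduct]
    exact Finset.sum_congr rfl fun x _ => by rw [restrictedMatrix_mulVec hN hF]
  have h3 := sum_mul_neighbors F
  have h4 : g ⬝ᵥ (restrictedMatrix V *ᵥ g) = ∑ x, F x ^ 2 -
      1 / (2 * (d : ℝ)) * ∑ i, ∑ x, (F (x + Pi.single i 1) - F x) ^ 2 := by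
    have e1 : ∑ x, F x * (1 / (2 * (d : ℝ)) * ∑ s, F (x + torusStep N s)) =
        1 / (2 * (d : ℝ)) * ∑ i : Fin d, ∑ x,
          F x * (F (x + Pi.single i 1) + F (x - Pi.single i 1)) := by
      rw [Finset.sum_comm, Finset.mul_sum]
      refine Finset.sum_congr rfl fun x _ => ?_
      rw [sum_torusStep, ← Finset.mul_sum]; ring
    rw [h2, e1]
    simp only [h3, Finset.sum_sub_distrib, Finset.sum_const, Finset.card_univ, Fintype.card_fin,
      nsmul_eq_mul]
    field_simp
  have h5 := sum_sq_le_torus d F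
  rw [h0] at h5
  rw [h4, h1]
  set D := ∑ i, ∑ x, (F (x + Pi.single i 1) - F x) ^ 2
  have h6 : 12 / (N : ℝ) ^ 2 * ∑ x, F x ^ 2 ≤ D := by
    rw [div_mul_eq_mul_div, div_le_iff₀ (by positivity)]
    simp only [ne_eq, OfNat.ofNat_ne_zero, not_false_eq_true, zero_pow, zero_div, add_zero] at h5
    linarith
  have h7 := mul_le_mul_of_nonneg_left h6 (by positivity : (0 : ℝ) ≤ 1 / (2 * (d : ℝ)))
  have h8 : 1 / (2 * (d : ℝ)) * (12 / (N : ℝ) ^ 2 * ∑ x, F x ^ 2) =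
      6 / (d * (N : ℝ) ^ 2) * ∑ x, F x ^ 2 := by
    field_simp; ring
  rw [sub_mul, one_mul]
  linarith

/-! ### Irreducibility -/

lemma exists_pow_pos_of_reflTransGen [NeZero N] {V : Set (Torus N d)} {x y : {x : Torus N d // x ∉ V}}
    (h : Relation.ReflTransGen (fun x y => 0 < restrictedMatrix V x y) x y) :
    ∃ n, 0 < (restrictedMatrix V ^ n) x y := by
  induction h with
  | refl => exact ⟨0, by simp⟩
  | @tail y z _ hyz ih =>
    obtain ⟨n, hn⟩ := ih
    refine ⟨n + 1, ?_⟩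
    rw [pow_succ, Matrix.mul_apply]
    exact Finset.sum_pos' (fun w _ => mul_nonneg
      (pow_apply_nonneg (restrictedMatrix_nonneg V) n x w) (restrictedMatrix_nonneg V w z))
      ⟨y, Finset.mem_univ _, mul_pos hn hyz⟩

/-- `x` and `y` are joined by a path outside `V`. -/
def Joined (V : Set (Torus N d)) (x y : Torus N d) : Prop :=
  ∃ (hx : x ∉ V) (hy : y ∉ V),
    Relation.ReflTransGen (fun x y => 0 < restrictedMatrix V x y) ⟨x, hx⟩ ⟨y, hy⟩

lemma Joined.trans {V : Set (Torus N d)} {x y z : Torus N d} (h : Joined V x y)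
    (h' : Joined V y z) : Joined V x z := by
  obtain ⟨hx, _, h⟩ := h
  obtain ⟨_, hz, h'⟩ := h'
  exact ⟨hx, hz, h.trans h'⟩

lemma joined_refl {V : Set (Torus N d)} {x : Torus N d} (hx : x ∉ V) : Joined V x x :=
  ⟨hx, hx, .refl⟩

lemma joined_add_torusStep (hN : 2 ≤ N) {V : Set (Torus N d)} {x : Torus N d} (hx : x ∉ V)
    (s : Fin d × Bool) (hy : x + torusStep N s ∉ V) : Joined V x (x + torusStep N s) := by
  refine ⟨hx, hy, .single ?_⟩
  have : (torusGraph N d).Adj x (x + torusStep N s) :=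
    (torusGraph_adj_iff hN _ _).mpr ⟨s, rfl⟩
  have hd : 0 < d := (Nat.zero_le _).trans_lt s.1.2
  simp only [restrictedMatrix, this, if_true]
  positivity

variable {V : Set (Torus N d)} {S : Set (ZMod N)}

/-- As long as the coordinate `i` keeps its value in `S`, the point stays outside `V`, and
coordinate `j` can go around the cycle by unit steps. -/
lemma joined_update [NeZero N] (hN : 2 ≤ N) (hV : ∀ x : Torus N d, x ∉ V ↔ ∃ i, x i ∈ S) {x : Torus N d}
    {i j : Fin d} (hi : x i ∈ S) (hij : i ≠ j) (b : ZMod N) :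
    Joined V x (Function.update x j b) := by
  have hk : ∀ k : ℕ, Joined V x (Function.update x j (x j + k)) := by
    intro k
    induction k with
    | zero =>
      simpa using joined_refl ((hV x).mpr ⟨i, hi⟩)
    | succ k ih =>
      have e : Function.update x j (x j + (k + 1 : ℕ)) =
          Function.update x j (x j + k) + torusStep N (j, true) := by
        funext m
        by_cases hm : m = j
        · subst hm; simp [torusStep, add_assoc]
        · simp [hm, torusStep]
      refine ih.trans ?_
      rw [e]
      refine joined_add_torusStep hN ih.2.1 _ ?_
      rw [← e]
      exact (hV _).mpr ⟨i, by rwa [Function.update_of_ne hij]⟩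
  have := hk (b - x j).val
  rwa [ZMod.natCast_zmod_val, add_sub_cancel] at this

lemma joined_piecewise [NeZero N] (hN : 2 ≤ N) (hV : ∀ x : Torus N d, x ∉ V ↔ ∃ i, x i ∈ S)
    {x : Torus N d} (y : Torus N d) {i : Fin d} (hi : x i ∈ S) (s : Finset (Fin d))
    (his : i ∉ s) : Joined V x (s.piecewise y x) := by
  induction s using Finset.induction_on with
  | empty => simpa using joined_refl ((hV x).mpr ⟨i, hi⟩)
  | insert j s hj ih =>
    rw [Finset.mem_insert, not_or] at his
    rw [Finset.piecewise_insert]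
    refine (ih his.2).trans (joined_update hN hV (i := i) ?_ his.1 _)
    rwa [Finset.piecewise_eq_of_notMem _ _ _ his.2]

lemma joined_of_apply_eq [NeZero N] (hN : 2 ≤ N) (hV : ∀ x : Torus N d, x ∉ V ↔ ∃ i, x i ∈ S)
    {x y : Torus N d} {i : Fin d} (hi : x i ∈ S) (hxy : x i = y i) : Joined V x y := by
  have h := joined_piecewise hN hV y hi (Finset.univ.erase i) (by simp)
  convert h using 1
  funext j
  by_cases hj : j = i
  · subst hj; simp [hxy]
  · simp [Finset.piecewise, hj]

lemma joined_of_ne [NeZero N] (hN : 2 ≤ N) (hV : ∀ x : Torus N d, x ∉ V ↔ ∃ i, x i ∈ S)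
    {x y : Torus N d} {i j : Fin d} (hi : x i ∈ S) (hj : y j ∈ S) (hij : i ≠ j) :
    Joined V x y :=
  (joined_update hN hV hi hij (y j)).trans
    (joined_of_apply_eq hN hV (i := j) (by simpa using hj) (by simp))

/-- Points in slabs of different directions are joined through the intersection of the slabs. For
two points in slabs of the same direction, the arc may be cut by nothing shorter than a detour: a
second coordinate is first moved into `S`, which needs d ≥ 2. -/
lemma restrictedMatrix_irreducible [NeZero N] (hN : 2 ≤ N) (hd : 2 ≤ d)
    (hV : ∀ x : Torus N d, x ∉ V ↔ ∃ i, x i ∈ S) (x y : {x : Torus N d // x ∉ V}) :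
    ∃ n, 0 < (restrictedMatrix V ^ n) x y := by
  have key : Joined V (x : Torus N d) y := by
    obtain ⟨i, hi⟩ := (hV x).mp x.2
    obtain ⟨j, hj⟩ := (hV y).mp y.2
    by_cases hij : i = j
    · subst hij
      have : Nontrivial (Fin d) := Fin.nontrivial_iff_two_le.mpr hd
      obtain ⟨k, hk⟩ := exists_ne i
      exact (joined_update hN hV hi hk.symm ((x : Torus N d) i)).trans
        (joined_of_ne hN hV (i := k) (by simpa using hi) hj hk)
    · exact joined_of_ne hN hV hi hj hij
  obtain ⟨_, _, h⟩ := key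
  exact exists_pow_pos_of_reflTransGen h

end Restricted

/-! ### Slabs and the sine subsolution -/

section Sine

/-- The residues in `ZMod N` whose distance to `0` exceeds `r`. -/
def arc (N r : ℕ) : Set (ZMod N) := {a | r < a.val ∧ a.val + r < N}

lemma notMem_box_iff {N d : ℕ} [NeZero N] {R : ℝ} (hR : 0 ≤ R) (x : Torus N d) :
    x ∉ box N d R ↔ ∃ i, x i ∈ arc N ⌊R⌋₊ := by
  simp only [box, Set.mem_ofPred_eq, not_forall, not_le]
  refine exists_congr fun i => ?_
  have h1 : |((x i).valMinAbs : ℝ)| = ((x i).valMinAbs.natAbs : ℝ) := by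
    rw [Nat.cast_natAbs, Int.cast_abs]
  rw [h1, ← Nat.floor_lt hR, ZMod.valMinAbs_natAbs_eq_min, lt_min_iff, arc, Set.mem_ofPred_eq]
  have := ZMod.val_lt (x i)
  constructor <;> rintro ⟨h, h'⟩ <;> exact ⟨h, by omega⟩

/-- The positive Dirichlet eigenfunction of an arc. -/
noncomputable def arcSine (N r : ℕ) (a : ZMod N) : ℝ :=
  if r < a.val ∧ a.val + r < N then Real.sin (Real.pi * (a.val - r) / (N - 2 * r)) else 0

variable {N r : ℕ}

/-- Jordan's inequality on the first half of the interval, and the symmetry of the sine on the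
second. -/
lemma two_div_le_sin {k L : ℝ} (hk : 1 ≤ k) (hkL : k ≤ L - 1) :
    2 / L ≤ Real.sin (Real.pi * k / L) := by
  have hL : 0 < L := by linarith
  have hpi := Real.pi_pos
  have key : ∀ j : ℝ, 1 ≤ j → j ≤ L / 2 → 2 / L ≤ Real.sin (Real.pi * j / L) := by
    intro j hj hjL
    have h1 : 0 ≤ Real.pi * j / L := by positivity
    have h2 : Real.pi * j / L ≤ Real.pi / 2 := by
      rw [div_le_iff₀ hL]; nlinarith
    refine le_trans ?_ (Real.mul_le_sin h1 h2)
    have : 2 / Real.pi * (Real.pi * j / L) = 2 * j / L := by field_simp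
    rw [this]
    exact div_le_div_of_nonneg_right (by linarith) hL.le
  rcases le_total k (L / 2) with h | h
  · exact key k hk h
  · have := key (L - k) (by linarith) (by linarith)
    have e : Real.pi * (L - k) / L = Real.pi - Real.pi * k / L := by field_simp
    rwa [e, Real.sin_pi_sub] at this

lemma arcSine_nonneg_le_one (a : ZMod N) : 0 ≤ arcSine N r a ∧ arcSine N r a ≤ 1 := by
  unfold arcSine
  split_ifs with h
  · refine ⟨Real.sin_nonneg_of_nonneg_of_le_pi ?_ ?_, Real.sin_le_one _⟩
    · have h1 : (r : ℝ) < a.val := by exact_mod_cast h.1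
      have h2 : (a.val : ℝ) + r < N := by exact_mod_cast h.2
      exact div_nonneg (mul_nonneg Real.pi_pos.le (by linarith)) (by linarith)
    · have h1 : (r : ℝ) < a.val := by exact_mod_cast h.1
      have h2 : (a.val : ℝ) + r < N := by exact_mod_cast h.2
      rw [div_le_iff₀ (by linarith)]
      exact mul_le_mul_of_nonneg_left (by linarith) Real.pi_pos.le
  · exact ⟨le_rfl, zero_le_one⟩

lemma arcSine_lower {a : ZMod N} (ha : a ∈ arc N r) : 2 / (N : ℝ) ≤ arcSine N r a := by
  obtain ⟨h1, h2⟩ := ha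
  rw [arcSine, if_pos ⟨h1, h2⟩]
  have h1' : (r : ℝ) + 1 ≤ a.val := by exact_mod_cast h1
  have h2' : (a.val : ℝ) + r + 1 ≤ N := by exact_mod_cast h2
  have h0 : (0 : ℝ) ≤ r := Nat.cast_nonneg r
  refine le_trans ?_ (two_div_le_sin (by linarith) (by linarith))
  exact div_le_div_of_nonneg_left (by norm_num) (by linarith) (by linarith)

lemma arcSine_of_notMem {a : ZMod N} (ha : a ∉ arc N r) : arcSine N r a = 0 := if_neg ha

/-- The formula extends to the two end points just outside the arc, where the sine vanishes. This
spares a case distinction for the neighbours of a point of the arc. -/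
lemma arcSine_natCast [NeZero N] {k : ℕ} (h1 : r ≤ k) (h2 : k + r ≤ N) (hk : k < N) :
    arcSine N r (k : ZMod N) = Real.sin (Real.pi * (k - r) / (N - 2 * r)) := by
  rw [arcSine, ZMod.val_cast_of_lt hk]
  split_ifs with h
  · rfl
  · rcases h1.eq_or_lt with rfl | h1
    · simp
    · have hN : k + r = N := by omega
      have hN' : (N : ℝ) = k + r := by exact_mod_cast hN.symm
      have h3 : (k : ℝ) - r ≠ 0 := by
        have : (r : ℝ) < k := by exact_mod_cast h1
        linarith
      have : (N : ℝ) - 2 * r = k - r := by rw [hN']; ring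
      rw [this, mul_div_assoc, div_self h3, mul_one, Real.sin_pi]

lemma arcSine_neighbors [NeZero N] (hr : 1 ≤ r) {a : ZMod N} (ha : a ∈ arc N r) :
    arcSine N r (a + 1) + arcSine N r (a - 1) =
      2 * Real.cos (Real.pi / (N - 2 * r)) * arcSine N r a := by
  obtain ⟨h1, h2⟩ := ha
  have ha : ((a.val : ℕ) : ZMod N) = a := by simp
  have hp : a + 1 = ((a.val + 1 : ℕ) : ZMod N) := by rw [Nat.cast_add, ha, Nat.cast_one]
  have hm : a - 1 = ((a.val - 1 : ℕ) : ZMod N) := by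
    rw [Nat.cast_sub (by omega), ha, Nat.cast_one]
  rw [hp, hm, arcSine_natCast (by omega) (by omega) (by omega),
    arcSine_natCast (by omega) (by omega) (by omega), arcSine, if_pos ⟨h1, h2⟩,
    Nat.cast_sub (by omega)]
  push_cast
  have e1 : Real.pi * ((a.val : ℝ) + 1 - r) / (N - 2 * r) =
      Real.pi * (a.val - r) / (N - 2 * r) + Real.pi / (N - 2 * r) := by ring
  have e2 : Real.pi * ((a.val : ℝ) - 1 - r) / (N - 2 * r) =
      Real.pi * (a.val - r) / (N - 2 * r) - Real.pi / (N - 2 * r) := by ring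
  rw [e1, e2, Real.sin_add, Real.sin_sub]
  ring

open Matrix
open scoped Classical

/-- The sine of an arc is a subsolution for the walk killed on a set whose complement contains the
corresponding slab. -/
lemma le_restrictedMatrix_mulVec_arcSine {d : ℕ} [NeZero N] (hN : 3 ≤ N) (hd : 1 ≤ d)
    (hr : 1 ≤ r) {V : Set (Torus N d)} (hV : ∀ x : Torus N d, x ∉ V ↔ ∃ i, x i ∈ arc N r)
    (i : Fin d) (x : {x : Torus N d // x ∉ V}) :
    (1 - (1 - Real.cos (Real.pi / (N - 2 * r))) / d) * arcSine N r ((x : Torus N d) i) ≤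
      (restrictedMatrix V *ᵥ
        fun z : {x : Torus N d // x ∉ V} => arcSine N r ((z : Torus N d) i)) x := by
  have hF : ∀ x ∈ V, arcSine N r (x i) = 0 := fun x hx =>
    arcSine_of_notMem fun h => (hV x).mpr ⟨i, h⟩ hx
  have hd0 : (0 : ℝ) < d := by positivity
  rw [restrictedMatrix_mulVec hN (F := fun x => arcSine N r (x i)) hF]
  by_cases hx : (x : Torus N d) i ∈ arc N r
  · rw [sum_torusStep (x : Torus N d) fun x => arcSine N r (x i)]
    have h1 : ∑ j, (arcSine N r (((x : Torus N d) + Pi.single j 1 : Torus N d) i) +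
        arcSine N r (((x : Torus N d) - Pi.single j 1 : Torus N d) i)) =
        2 * Real.cos (Real.pi / (N - 2 * r)) * arcSine N r ((x : Torus N d) i) +
          (d - 1) * (2 * arcSine N r ((x : Torus N d) i)) := by
      rw [← Finset.add_sum_erase _ _ (Finset.mem_univ i)]
      congr 1
      · simp [arcSine_neighbors hr hx]
      · rw [Finset.sum_congr rfl (g := fun _ => 2 * arcSine N r ((x : Torus N d) i))]
        · rw [Finset.sum_const, Finset.card_erase_of_mem (Finset.mem_univ i), Finset.card_univ,
            Fintype.card_fin, nsmul_eq_mul, Nat.cast_sub hd, Nat.cast_one]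
        · intro j hj
          have : i ≠ j := (Finset.ne_of_mem_erase hj).symm
          simp only [Pi.add_apply, Pi.sub_apply, Pi.single_eq_of_ne this, add_zero, sub_zero]
          ring
    rw [h1]
    refine le_of_eq ?_
    field_simp
    ring
  -- Off the slab the function is zero and its neighbour average nonnegative; only here can the
  -- inequality be strict.
  · rw [arcSine_of_notMem hx, mul_zero]
    exact mul_nonneg (by positivity) (Finset.sum_nonneg fun s _ => (arcSine_nonneg_le_one _).1)

end Sine

open scoped ENNReal

/-! ### First-step decomposition of an i.i.d. sequence -/

section SeqCons

variable {α : Type*}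

/-- Prepend a term to a sequence. -/
def seqCons (a : α) (g : ℕ → α) : ℕ → α
  | 0 => a
  | n + 1 => g n

variable [MeasurableSpace α]

lemma measurable_seqCons : Measurable fun p : α × (ℕ → α) => seqCons p.1 p.2 := by
  refine measurable_pi_iff.mpr fun n => ?_
  cases n with
  | zero => exact measurable_fst
  | succ n => exact (measurable_pi_apply n).comp measurable_snd

/-- The first term of an i.i.d. sequence is independent of the shifted sequence, which has the same
law as the sequence. -/
lemma map_seqCons_infinitePi (P : Measure α) [IsProbabilityMeasure P] :
    (P.prod (Measure.infinitePi fun _ : ℕ => P)).map (fun p => seqCons p.1 p.2) =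
      Measure.infinitePi fun _ : ℕ => P := by
  classical
  refine Measure.eq_infinitePi _ fun s t ht => ?_
  obtain ⟨m, hm⟩ : ∃ m, s ⊆ Finset.range (m + 1) :=
    ⟨s.sup id, fun i hi => Finset.mem_range_succ_iff.mpr (Finset.le_sup (f := id) hi)⟩
  -- Padding with the whole space turns `s` into an initial segment, from which coordinate 0 can be
  -- split off.
  set t' : ℕ → Set α := fun i => if i ∈ s then t i else Set.univ with ht'_def
  have ht' : ∀ i, MeasurableSet (t' i) := fun i => by
    simp only [ht'_def]; split_ifs; exacts [ht i, .univ]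
  have hpi : Set.pi (s : Set ℕ) t = Set.pi (Finset.range (m + 1) : Set ℕ) t' := by
    ext g
    simp only [Set.mem_pi, Finset.mem_coe, ht'_def]
    constructor
    · intro h i _
      split_ifs with his
      exacts [h i his, Set.mem_univ _]
    · intro h i hi
      have := h i (hm hi)
      rwa [if_pos hi] at this
  have hprod : ∏ i ∈ s, P (t i) = ∏ i ∈ Finset.range (m + 1), P (t' i) := by
    rw [← Finset.prod_subset hm (f := fun i => P (t' i))]
    · refine Finset.prod_congr rfl fun i hi => ?_
      simp only [ht'_def]; rw [if_pos hi]
    · intro i _ hi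
      simp only [ht'_def]; rw [if_neg hi, measure_univ]
  have hpre : (fun p : α × (ℕ → α) => seqCons p.1 p.2) ⁻¹'
      Set.pi (Finset.range (m + 1) : Set ℕ) t' =
      t' 0 ×ˢ Set.pi (Finset.range m : Set ℕ) fun i => t' (i + 1) := by
    ext ⟨a, g⟩
    simp only [Set.mem_preimage, Set.mem_pi, Finset.mem_coe, Finset.mem_range, Set.mem_prod]
    constructor
    · intro h
      exact ⟨h 0 (by omega), fun i hi => h (i + 1) (by omega)⟩
    · rintro ⟨h0, h⟩ i hi
      cases i with
      | zero => exact h0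
      | succ i => exact h i (by omega)
  rw [Measure.map_apply measurable_seqCons
    (.pi s.countable_toSet fun i _ => ht i), hpi, hpre, Measure.prod_prod,
    Measure.infinitePi_pi _ (fun i _ => ht' (i + 1)), hprod, Finset.prod_range_succ', mul_comm]

lemma infinitePi_apply_eq_lintegral (P : Measure α) [IsProbabilityMeasure P]
    {E : Set (ℕ → α)} (hE : MeasurableSet E) :
    Measure.infinitePi (fun _ : ℕ => P) E =
      ∫⁻ a, Measure.infinitePi (fun _ : ℕ => P) {g | seqCons a g ∈ E} ∂P := by
  conv_lhs => rw [← map_seqCons_infinitePi P]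
  rw [Measure.map_apply measurable_seqCons hE, Measure.prod_apply (measurable_seqCons hE)]
  rfl

end SeqCons

/-! ### The Poisson process built from exponential gaps -/

section Gaps

/-- The law of the gaps. -/
noncomputable def gapMeasure : Measure (ℕ → ℝ) := Measure.infinitePi fun _ : ℕ => expMeasure 1

instance : IsProbabilityMeasure (expMeasure 1) := isProbabilityMeasure_expMeasure one_pos

instance : IsProbabilityMeasure gapMeasure := by unfold gapMeasure; infer_instance

/-- Partial sums of the gaps. -/
def partialSum (n : ℕ) (g : ℕ → ℝ) : ℝ := ∑ k ∈ Finset.range n, g k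

lemma measurable_partialSum (n : ℕ) : Measurable (partialSum n) := by
  unfold partialSum
  fun_prop

lemma partialSum_seqCons (n : ℕ) (a : ℝ) (g : ℕ → ℝ) :
    partialSum (n + 1) (seqCons a g) = a + partialSum n g := by
  rw [partialSum, Finset.sum_range_succ', add_comm]
  rfl

/-- The gaps for which exactly `n` points lie in `[0, t]`. -/
def countEvent (n : ℕ) (t : ℝ) : Set (ℕ → ℝ) := {g | partialSum n g ≤ t ∧ t < partialSum (n + 1) g}

lemma measurableSet_countEvent (n : ℕ) (t : ℝ) : MeasurableSet (countEvent n t) :=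
  (measurableSet_le (measurable_partialSum n) measurable_const).inter
    (measurableSet_lt measurable_const (measurable_partialSum (n + 1)))

lemma lintegral_expMeasure (f : ℝ → ℝ≥0∞) (hf : Measurable f) :
    ∫⁻ s, f s ∂expMeasure 1 = ∫⁻ s in Set.Ici 0, ENNReal.ofReal (Real.exp (-s)) * f s := by
  have hm : Measurable (gammaPDF 1 1) := (measurable_gammaPDFReal 1 1).ennreal_ofReal
  rw [expMeasure, gammaMeasure, lintegral_withDensity_eq_lintegral_mul _ hm hf,
    ← lintegral_indicator measurableSet_Ici]
  refine lintegral_congr fun s => ?_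
  have := exponentialPDF_eq 1 s
  rw [exponentialPDF, exponentialPDFReal] at this
  rw [Pi.mul_apply, gammaPDF, this]
  by_cases hs : 0 ≤ s
  · simp [hs]
  · simp [hs]

lemma expMeasure_Ioi {t : ℝ} (ht : 0 ≤ t) :
    expMeasure 1 (Set.Ioi t) = ENNReal.ofReal (Real.exp (-t)) := by
  have h := cdf_expMeasure_eq one_pos t
  rw [if_pos ht, cdf_eq_real, one_mul] at h
  have h2 : Set.Ioi t = (Set.Iic t)ᶜ := Set.compl_Iic.symm
  rw [h2, ← ENNReal.ofReal_toReal (measure_ne_top (expMeasure 1) (Set.Iic t)ᶜ)]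
  congr 1
  have h3 := probReal_compl_eq_one_sub (μ := expMeasure 1) (measurableSet_Iic (a := t))
  rw [measureReal_def] at h3
  rw [h3, h]; ring

lemma lintegral_Icc_pow {t : ℝ} (ht : 0 ≤ t) (n : ℕ) :
    ∫⁻ s in Set.Icc 0 t, ENNReal.ofReal ((t - s) ^ n / n.factorial) =
      ENNReal.ofReal (t ^ (n + 1) / (n + 1).factorial) := by
  rw [← ofReal_integral_eq_lintegral_ofReal]
  · congr 1
    rw [integral_Icc_eq_integral_Ioc, ← intervalIntegral.integral_of_le ht,
      intervalIntegral.integral_comp_sub_left (fun s => s ^ n / (n.factorial : ℝ)) t]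
    rw [intervalIntegral.integral_div, integral_pow, Nat.factorial_succ]
    push_cast
    simp
    field_simp
  · exact (Continuous.integrableOn_Icc (by fun_prop))
  · refine (ae_restrict_iff' measurableSet_Icc).mpr (.of_forall fun s hs => ?_)
    have : 0 ≤ t - s := sub_nonneg.mpr hs.2
    simp only [Pi.zero_apply]
    positivity

/-- Condition on the first gap s: the densities multiply to exp(-s) exp(-(t-s)) = exp(-t), and
integrating (t-s)^n/n! raises the degree by one. Negative times are included because the first gap
may exceed t. -/
lemma gapMeasure_countEvent (n : ℕ) (t : ℝ) :
    gapMeasure (countEvent n t) = if 0 ≤ t then ENNReal.ofReal (poissonWeight t n) else 0 := by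
  induction n generalizing t with
  | zero =>
    have hE : countEvent 0 t = {g | 0 ≤ t ∧ t < g 0} := by
      ext g; simp [countEvent, partialSum]
    rw [hE]
    split_ifs with ht
    · have h : {g : ℕ → ℝ | 0 ≤ t ∧ t < g 0} = (fun g => g 0) ⁻¹' Set.Ioi t := by
        ext g; simp [ht]
      rw [h, gapMeasure, ← Measure.map_apply (measurable_pi_apply 0) measurableSet_Ioi,
        Measure.infinitePi_map_eval (fun _ : ℕ => expMeasure 1) 0, expMeasure_Ioi ht]
      simp [poissonWeight]
    · simp [ht]
  | succ n ih =>
    have hE : ∀ a, {g | seqCons a g ∈ countEvent (n + 1) t} = countEvent n (t - a) := by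
      intro a
      ext g
      simp only [countEvent, Set.mem_ofPred_eq, partialSum_seqCons]
      constructor <;> rintro ⟨h1, h2⟩ <;> constructor <;> linarith
    have hind : ∀ a, gapMeasure (countEvent n (t - a)) =
        (Set.Iic t).indicator (fun a => ENNReal.ofReal (poissonWeight (t - a) n)) a := by
      intro a
      rw [ih]
      by_cases h : a ≤ t <;> simp [h, Set.indicator]
    have hmeas : Measurable fun a : ℝ => ENNReal.ofReal (poissonWeight (t - a) n) := by
      unfold poissonWeight; fun_prop
    rw [gapMeasure, infinitePi_apply_eq_lintegral _ (measurableSet_countEvent _ _)]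
    simp only [hE]
    rw [← gapMeasure, lintegral_congr hind,
      lintegral_expMeasure _ (hmeas.indicator measurableSet_Iic)]
    have h1 : ∀ s, ENNReal.ofReal (Real.exp (-s)) *
        (Set.Iic t).indicator (fun a => ENNReal.ofReal (poissonWeight (t - a) n)) s =
        (Set.Iic t).indicator (fun s => ENNReal.ofReal (Real.exp (-t)) *
          ENNReal.ofReal ((t - s) ^ n / n.factorial)) s := by
      intro s
      by_cases h : s ≤ t
      · simp only [Set.indicator, Set.mem_Iic, h, if_true]
        rw [← ENNReal.ofReal_mul (Real.exp_pos _).le, ← ENNReal.ofReal_mul (Real.exp_pos _).le,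
          poissonWeight, ← mul_assoc, ← Real.exp_add]
        congr 3
        ring
      · simp [h, Set.indicator]
    simp only [h1]
    rw [lintegral_indicator measurableSet_Iic, Measure.restrict_restrict measurableSet_Iic,
      Set.inter_comm, Set.Ici_inter_Iic]
    split_ifs with ht
    · rw [lintegral_const_mul _ (by fun_prop), lintegral_Icc_pow ht,
        ← ENNReal.ofReal_mul (Real.exp_pos _).le]
      rfl
    · rw [Set.Icc_eq_empty ht]; simp

/-- Sequences of positive gaps. -/
def positiveGaps : Set (ℕ → ℝ) := {g | ∀ k, 0 < g k}

lemma measurableSet_positiveGaps : MeasurableSet positiveGaps := by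
  have : positiveGaps = ⋂ k, {g : ℕ → ℝ | 0 < g k} := by ext; simp [positiveGaps]
  rw [this]
  exact MeasurableSet.iInter fun k => measurableSet_lt measurable_const (measurable_pi_apply k)

lemma ae_mem_positiveGaps : ∀ᵐ g ∂gapMeasure, g ∈ positiveGaps := by
  have : ∀ k : ℕ, ∀ᵐ g ∂gapMeasure, 0 < g k := by
    intro k
    have h1 : ∀ᵐ s ∂expMeasure 1, s ∈ Set.Ioi (0 : ℝ) :=
      (mem_ae_iff_prob_eq_one₀ measurableSet_Ioi.nullMeasurableSet).mpr
        (by simp [expMeasure_Ioi le_rfl])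
    exact (measurePreserving_eval_infinitePi (fun _ : ℕ => expMeasure 1)
      k).quasiMeasurePreserving.ae h1
  exact ae_all_iff.mpr this

/-- The gaps are positive and exactly `n` points lie in `[0, t]`. -/
def goodCountEvent (n : ℕ) (t : ℝ) : Set (ℕ → ℝ) := positiveGaps ∩ countEvent n t

lemma measurableSet_goodCountEvent (n : ℕ) (t : ℝ) : MeasurableSet (goodCountEvent n t) :=
  measurableSet_positiveGaps.inter (measurableSet_countEvent n t)

lemma gapMeasure_goodCountEvent (n : ℕ) {t : ℝ} (ht : 0 ≤ t) :
    gapMeasure (goodCountEvent n t) = ENNReal.ofReal (poissonWeight t n) := by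
  rw [goodCountEvent, Measure.measure_inter_eq_of_ae ae_mem_positiveGaps, gapMeasure_countEvent,
    if_pos ht]

lemma strictMono_partialSum {g : ℕ → ℝ} (hg : g ∈ positiveGaps) :
    StrictMono fun n => partialSum n g :=
  strictMono_nat_of_lt_succ fun n => by
    simp only [partialSum]
    rw [Finset.sum_range_succ]
    linarith [hg n]

lemma eq_of_mem_countEvent {g : ℕ → ℝ} (hg : g ∈ positiveGaps) {m n : ℕ} {t : ℝ}
    (hm : g ∈ countEvent m t) (hn : g ∈ countEvent n t) : m = n := by
  have hs := strictMono_partialSum hg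
  have h1 : m < n + 1 := hs.lt_iff_lt.mp (hm.1.trans_lt hn.2)
  have h2 : n < m + 1 := hs.lt_iff_lt.mp (hn.1.trans_lt hm.2)
  omega

lemma pairwise_disjoint_goodCountEvent (t : ℝ) :
    Pairwise (Function.onFun Disjoint fun n => goodCountEvent n t) := by
  intro m n hmn
  rw [Function.onFun, Set.disjoint_left]
  rintro g ⟨hg, hm⟩ ⟨-, hn⟩
  exact hmn (eq_of_mem_countEvent hg hm hn)

/-- The Poisson weights sum to 1, so the disjoint counting events have full measure; in particular
almost surely only finitely many points lie in `[0, t]`. -/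
lemma ae_exists_mem_goodCountEvent {t : ℝ} (ht : 0 ≤ t) :
    ∀ᵐ g ∂gapMeasure, ∃ n, g ∈ goodCountEvent n t := by
  have h : gapMeasure (⋃ n, goodCountEvent n t) = 1 := by
    rw [measure_iUnion (pairwise_disjoint_goodCountEvent t)
      fun n => measurableSet_goodCountEvent n t]
    simp only [gapMeasure_goodCountEvent _ ht]
    have hs := hasSum_poissonWeight_mul_pow t 1
    simp only [one_pow, mul_one, sub_self, mul_zero, Real.exp_zero] at hs
    rw [← ENNReal.ofReal_tsum_of_nonneg (poissonWeight_nonneg ht) hs.summable, hs.tsum_eq,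
      ENNReal.ofReal_one]
  have h2 := (prob_compl_eq_zero_iff
    (MeasurableSet.iUnion fun n => measurableSet_goodCountEvent n t)).mpr h
  filter_upwards [compl_mem_ae_iff.mpr h2] with g hg
  simpa using hg

end Gaps

/-! ### The killed discrete walk and powers of the restricted matrix -/

section Steps

variable {N d : ℕ}

/-- The law of the steps. -/
noncomputable def stepMeasure (d : ℕ) : Measure (ℕ → Fin d × Bool) :=
  Measure.infinitePi fun _ : ℕ => uniformOn (Set.univ : Set (Fin d × Bool))

lemma isProbabilityMeasure_uniformOn_steps (hd : 1 ≤ d) :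
    IsProbabilityMeasure (uniformOn (Set.univ : Set (Fin d × Bool))) :=
  isProbabilityMeasure_uniformOn Set.finite_univ ⟨(⟨0, hd⟩, true), Set.mem_univ _⟩

lemma isProbabilityMeasure_stepMeasure (hd : 1 ≤ d) : IsProbabilityMeasure (stepMeasure d) := by
  have := isProbabilityMeasure_uniformOn_steps hd
  unfold stepMeasure
  infer_instance

/-- The position after `n` steps. -/
def walkPos (x : Torus N d) (n : ℕ) (st : ℕ → Fin d × Bool) : Torus N d :=
  x + ∑ k ∈ Finset.range n, torusStep N (st k)

lemma discreteWalk_eq_walkPos (x : Torus N d) (n : ℕ) (ω : Sample d) :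
    discreteWalk x n ω = walkPos x n ω.1 := by
  funext i
  simp [discreteWalk, walkPos, latticeWalk, Finset.sum_apply, intCast_stepVec]

lemma walkPos_seqCons (x : Torus N d) (n : ℕ) (s : Fin d × Bool) (st : ℕ → Fin d × Bool) :
    walkPos x (n + 1) (seqCons s st) = walkPos (x + torusStep N s) n st := by
  rw [walkPos, Finset.sum_range_succ', walkPos, add_comm (∑ k ∈ _, _), add_assoc]
  rfl

lemma measurableSet_walkPos_eq (x : Torus N d) (n : ℕ) (y : Torus N d) :
    MeasurableSet {st | walkPos x n st = y} := by
  induction n generalizing y with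
  | zero => simp [walkPos]
  | succ n ih =>
    have : {st : ℕ → Fin d × Bool | walkPos x (n + 1) st = y} =
        ⋃ s, {st | st n = s} ∩ {st | walkPos x n st = y - torusStep N s} := by
      ext st
      simp [walkPos, Finset.sum_range_succ, eq_sub_iff_add_eq, add_assoc]
    rw [this]
    refine MeasurableSet.iUnion fun s => MeasurableSet.inter ?_ (ih _)
    have h : Measurable fun st : ℕ → Fin d × Bool => st n := measurable_pi_apply n
    exact h (measurableSet_singleton s)

/-- The step sequences whose walk from `x` avoids `V` up to time `n` and is at `y` at time `n`. -/
def survivalEvent (V : Set (Torus N d)) (x y : Torus N d) (n : ℕ) : Set (ℕ → Fin d × Bool) :=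
  {st | (∀ k ≤ n, walkPos x k st ∉ V) ∧ walkPos x n st = y}

lemma measurableSet_survivalEvent [NeZero N] (V : Set (Torus N d)) (x y : Torus N d) (n : ℕ) :
    MeasurableSet (survivalEvent V x y n) := by
  have : survivalEvent V x y n =
      (⋂ k ∈ Finset.range (n + 1), ⋂ z ∈ V, {st | walkPos x k st = z}ᶜ) ∩
        {st | walkPos x n st = y} := by
    ext st
    simp only [survivalEvent, Set.mem_ofPred_eq, Set.mem_inter_iff, Set.mem_iInter,
      Finset.mem_range, Nat.lt_succ_iff, Set.mem_compl_iff]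
    refine and_congr_left fun _ => forall₂_congr fun k _ => ?_
    exact ⟨fun h z hz hzk => h (hzk ▸ hz), fun h hk => h _ hk rfl⟩
  rw [this]
  refine MeasurableSet.inter ?_ (measurableSet_walkPos_eq x n y)
  exact Finset.measurableSet_biInter _ fun k _ =>
    MeasurableSet.biInter V.to_countable fun z _ => (measurableSet_walkPos_eq x k z).compl

open scoped Classical in
/-- The powers of the restricted matrix give the law of the killed walk. -/
lemma stepMeasure_survivalEvent [NeZero N] (hN : 3 ≤ N) (hd : 1 ≤ d) (V : Set (Torus N d))
    (x y : {x : Torus N d // x ∉ V}) (n : ℕ) :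
    stepMeasure d (survivalEvent V x y n) = ENNReal.ofReal ((restrictedMatrix V ^ n) x y) := by
  have hP := isProbabilityMeasure_uniformOn_steps hd
  induction n generalizing x with
  | zero =>
    have : survivalEvent V x y 0 = if x = y then Set.univ else ∅ := by
      ext st
      split_ifs with h
      · simp [survivalEvent, walkPos, h, y.2]
      · simp [survivalEvent, walkPos, Subtype.ext_iff.not.mp h]
    rw [this, pow_zero, Matrix.one_apply]
    have := isProbabilityMeasure_stepMeasure hd
    split_ifs <;> simp
  | succ n ih =>
    have hE : ∀ s, {st | seqCons s st ∈ survivalEvent V x y (n + 1)} =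
        survivalEvent V ((x : Torus N d) + torusStep N s) y n := by
      intro s
      ext st
      simp only [survivalEvent, Set.mem_ofPred_eq, walkPos_seqCons]
      refine and_congr_left fun _ => ⟨fun h k hk => ?_, fun h k hk => ?_⟩
      · have := h (k + 1) (by omega)
        rwa [walkPos_seqCons] at this
      · cases k with
        | zero => simpa [walkPos] using x.2
        | succ k =>
          rw [walkPos_seqCons]
          exact h k (by omega)
    -- Induction by conditioning on the first step; the value 0 on `V` accounts for the steps that
    -- kill the walk.
    set F : Torus N d → ℝ := fun z => if h : z ∉ V then (restrictedMatrix V ^ n) ⟨z, h⟩ y else 0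
      with hF_def
    have hF0 : ∀ z ∈ V, F z = 0 := fun z hz => by simp [hF_def, hz]
    have hFn : ∀ z, 0 ≤ F z := fun z => by
      simp only [hF_def]
      split_ifs
      exacts [le_rfl, pow_apply_nonneg (restrictedMatrix_nonneg V) n _ _]
    have hEF : ∀ z, stepMeasure d (survivalEvent V z y n) = ENNReal.ofReal (F z) := by
      intro z
      by_cases hz : z ∈ V
      · have : survivalEvent V z y n = ∅ := by
          refine Set.eq_empty_of_forall_notMem fun st hst => hst.1 0 (Nat.zero_le n) ?_
          simpa [walkPos] using hz
        rw [this, hF0 z hz]; simp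
      · rw [ih ⟨z, hz⟩]
        simp only [hF_def]
        rw [dif_pos hz]
    have hmul : (restrictedMatrix V ^ (n + 1)) x y =
        1 / (2 * (d : ℝ)) * ∑ s, F ((x : Torus N d) + torusStep N s) := by
      rw [← restrictedMatrix_mulVec hN hF0, pow_succ', Matrix.mul_apply]
      refine Finset.sum_congr rfl fun z _ => ?_
      simp only [hF_def]
      rw [dif_pos z.2]
    have hd0 : (0 : ℝ) < d := by positivity
    rw [stepMeasure, infinitePi_apply_eq_lintegral _ (measurableSet_survivalEvent _ _ _ _),
      lintegral_fintype, hmul, Finset.mul_sum,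
      ENNReal.ofReal_sum_of_nonneg fun s _ => mul_nonneg (by positivity) (hFn _)]
    refine Finset.sum_congr rfl fun s _ => ?_
    have hs : uniformOn (Set.univ : Set (Fin d × Bool)) {s} =
        ENNReal.ofReal (1 / (2 * (d : ℝ))) := by
      rw [uniformOn_univ]
      simp only [Measure.count_singleton, Fintype.card_prod, Fintype.card_fin, Fintype.card_bool]
      rw [ENNReal.ofReal_div_of_pos (by positivity)]
      simp [mul_comm, ENNReal.ofReal_mul]
    rw [hE, ← stepMeasure, hEF, hs, mul_comm, ENNReal.ofReal_mul (by positivity)]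

end Steps

/-! ### From continuous-time paths to the Poissonized kernel -/

section Paths

variable {N d : ℕ}

lemma jumpTime_eq_partialSum (n : ℕ) (ω : Sample d) : jumpTime n ω = partialSum n ω.2 := rfl

lemma poissonCount_of_mem {ω : Sample d} (hg : ω.2 ∈ positiveGaps) {n : ℕ} {t : ℝ}
    (h : ω.2 ∈ countEvent n t) : poissonCount t ω = n := by
  have hs := strictMono_partialSum hg
  have : {m : ℕ | 1 ≤ m ∧ jumpTime m ω ≤ t} = Set.Icc 1 n := by
    ext m
    simp only [Set.mem_ofPred_eq, Set.mem_Icc, jumpTime_eq_partialSum]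
    refine and_congr_right fun _ => ⟨fun hm => ?_, fun hm => ?_⟩
    · exact Nat.lt_succ_iff.mp (hs.lt_iff_lt.mp (hm.trans_lt h.2))
    · exact (hs.monotone hm).trans h.1
  rw [poissonCount, this, ← Finset.coe_Icc, Set.ncard_coe_finset, Nat.card_Icc]
  omega

lemma exists_mem_countEvent {g : ℕ → ℝ} {n : ℕ} {s : ℝ} (hs0 : 0 ≤ s)
    (hs : s < partialSum (n + 1) g) : ∃ m ≤ n, g ∈ countEvent m s := by
  classical
  have hex : ∃ j, s < partialSum j g := ⟨n + 1, hs⟩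
  have h1 := Nat.find_spec hex
  have h2 : Nat.find hex ≠ 0 := by
    intro h
    rw [h] at h1
    simp [partialSum] at h1
    linarith
  obtain ⟨m, hm⟩ := Nat.exists_eq_succ_of_ne_zero h2
  have h3 : Nat.find hex ≤ n + 1 := Nat.find_min' hex hs
  refine ⟨m, by omega, ?_, by rwa [hm] at h1⟩
  exact not_lt.mp (Nat.find_min hex (by omega : m < Nat.find hex))

/-- On the event that exactly `n` points of the Poisson process lie in `[0, t]`, the set `V` is not
entered up to time `t` if and only if the first `n` steps of the discrete walk avoid `V`. -/
lemma lt_entranceTime_iff {ω : Sample d} (hg : ω.2 ∈ positiveGaps) {n : ℕ} {t : ℝ}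
    (h : ω.2 ∈ countEvent n t) (x : Torus N d) (V : Set (Torus N d)) :
    (t : WithTop ℝ) < entranceTime x V ω ↔ ∀ k ≤ n, walkPos x k ω.1 ∉ V := by
  have hs := strictMono_partialSum hg
  have hY : ∀ {m : ℕ} {s : ℝ}, ω.2 ∈ countEvent m s → contWalk x s ω = walkPos x m ω.1 := by
    intro m s hm
    rw [contWalk, poissonCount_of_mem hg hm, discreteWalk_eq_walkPos]
  constructor
  · intro ht k hk
    have h0 : (0 : ℝ) ≤ partialSum k ω.2 := by
      simpa [partialSum] using hs.monotone (Nat.zero_le k)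
    have hkt : partialSum k ω.2 ≤ t := (hs.monotone hk).trans h.1
    have := notMem_of_lt_hittingAfter (u := contWalk x) (k := partialSum k ω.2)
      (lt_of_le_of_lt (WithTop.coe_le_coe.mpr hkt) ht) h0
    rwa [hY ⟨le_rfl, hs (Nat.lt_succ_self k)⟩] at this
  · intro hV
    have hnot : ∀ s, 0 ≤ s → s < partialSum (n + 1) ω.2 → contWalk x s ω ∉ V := by
      intro s hs0 hs1
      obtain ⟨m, hm, hms⟩ := exists_mem_countEvent hs0 hs1
      rw [hY hms]
      exact hV m hm
    rw [entranceTime, hittingAfter_def]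
    simp only
    split_ifs with hex
    -- No entrance occurs before the jump time with index `n + 1`, which is strictly later than `t`;
    -- this keeps the inequality strict for the infimum.
    · refine WithTop.coe_lt_coe.mpr (h.2.trans_le (le_csInf hex fun s hs1 => ?_))
      by_contra! hlt
      exact hnot s hs1.1 hlt hs1.2
    · exact WithTop.coe_lt_top t

/-- The paths that start at `x`, have not entered `V` by time `t` and are at `y` at time `t`. -/
def survivalSet (V : Set (Torus N d)) (t : ℝ) (x y : Torus N d) : Set (Sample d) :=
  {ω | contWalk x t ω = y} ∩ {ω | (t : WithTop ℝ) < entranceTime x V ω}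

lemma walkMeasure_eq_prod : walkMeasure d = (stepMeasure d).prod gapMeasure := rfl

/-- Off a null set the path event splits by the number of jumps into products of a step event and a
gap event. This yields both its null measurability and its measure. -/
lemma survivalSet_ae_eq (hd : 1 ≤ d) (V : Set (Torus N d)) {t : ℝ} (ht : 0 ≤ t)
    (x y : Torus N d) : survivalSet V t x y =ᵐ[walkMeasure d]
      ⋃ n, survivalEvent V x y n ×ˢ goodCountEvent n t := by
  have := isProbabilityMeasure_stepMeasure hd
  have hae : ∀ᵐ ω ∂walkMeasure d, ∃ n, ω.2 ∈ goodCountEvent n t := by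
    rw [walkMeasure_eq_prod]
    exact Measure.quasiMeasurePreserving_snd.ae (ae_exists_mem_goodCountEvent ht)
  rw [Filter.eventuallyEq_set]
  filter_upwards [hae] with ω hω
  obtain ⟨n, hg, hn⟩ := hω
  simp only [survivalSet, Set.mem_inter_iff, Set.mem_ofPred_eq, Set.mem_iUnion, Set.mem_prod]
  rw [lt_entranceTime_iff hg hn, contWalk, poissonCount_of_mem hg hn, discreteWalk_eq_walkPos]
  constructor
  · rintro ⟨h1, h2⟩
    exact ⟨n, ⟨h2, h1⟩, hg, hn⟩
  · rintro ⟨m, ⟨h1, h2⟩, -, hm⟩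
    obtain rfl := eq_of_mem_countEvent hg hm hn
    exact ⟨h2, h1⟩

variable [NeZero N]

lemma measurableSet_iUnion_survival (V : Set (Torus N d)) (t : ℝ) (x y : Torus N d) :
    MeasurableSet (⋃ n, survivalEvent V x y n ×ˢ goodCountEvent n t) :=
  MeasurableSet.iUnion fun n =>
    (measurableSet_survivalEvent V x y n).prod (measurableSet_goodCountEvent n t)

lemma nullMeasurableSet_survivalSet (hd : 1 ≤ d) (V : Set (Torus N d)) {t : ℝ} (ht : 0 ≤ t)
    (x y : Torus N d) : NullMeasurableSet (survivalSet V t x y) (walkMeasure d) :=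
  (measurableSet_iUnion_survival V t x y).nullMeasurableSet.congr
    (survivalSet_ae_eq hd V ht x y).symm

lemma walkMeasure_survivalSet (hd : 1 ≤ d) (V : Set (Torus N d)) {t : ℝ} (ht : 0 ≤ t)
    (x y : Torus N d) : walkMeasure d (survivalSet V t x y) =
      ∑' n, stepMeasure d (survivalEvent V x y n) * ENNReal.ofReal (poissonWeight t n) := by
  have := isProbabilityMeasure_stepMeasure hd
  rw [measure_congr (survivalSet_ae_eq hd V ht x y), walkMeasure_eq_prod,
    measure_iUnion _ fun n =>
      (measurableSet_survivalEvent V x y n).prod (measurableSet_goodCountEvent n t)]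
  · simp only [Measure.prod_prod, gapMeasure_goodCountEvent _ ht]
  · intro m n hmn
    exact Set.Disjoint.set_prod_right (pairwise_disjoint_goodCountEvent t hmn) _ _

open scoped Classical in
/-- The law of the walk killed on `V`. -/
lemma hasSum_walkMeasure_survivalSet (hN : 3 ≤ N) (hd : 1 ≤ d) (V : Set (Torus N d)) {t : ℝ}
    (ht : 0 ≤ t) (x y : {x : Torus N d // x ∉ V}) :
    HasSum (fun n => poissonWeight t n * (restrictedMatrix V ^ n) x y)
      ((walkMeasure d).real (survivalSet V t x y)) := by
  have := isProbabilityMeasure_stepMeasure hd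
  have hfin : walkMeasure d (survivalSet V t x y) ≠ ∞ := by
    rw [walkMeasure_eq_prod]; exact measure_ne_top _ _
  rw [measureReal_def]
  rw [walkMeasure_survivalSet hd V ht] at hfin ⊢
  simp only [stepMeasure_survivalEvent hN hd] at hfin ⊢
  rw [ENNReal.tsum_toReal_eq (ENNReal.ne_top_of_tsum_ne_top hfin)]
  have h := ENNReal.hasSum_toReal hfin
  convert h using 2 with n
  rw [ENNReal.toReal_mul, ENNReal.toReal_ofReal (poissonWeight_nonneg ht n),
    ENNReal.toReal_ofReal (pow_apply_nonneg (restrictedMatrix_nonneg V) n x y), mul_comm]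

lemma walkMeasure_survivalSet_of_mem (hd : 1 ≤ d) {V : Set (Torus N d)} {t : ℝ} (ht : 0 ≤ t)
    (x : Torus N d) {y : Torus N d} (hy : y ∈ V) : walkMeasure d (survivalSet V t x y) = 0 := by
  rw [walkMeasure_survivalSet hd V ht]
  have : ∀ n, survivalEvent V x y n = ∅ := fun n =>
    Set.eq_empty_of_forall_notMem fun st hst => hst.1 n le_rfl (hst.2 ▸ hy)
  simp [this]

open scoped Classical in
/-- The conditional law given survival is the normalized law of the killed walk. -/
lemma condLaw_eq_div (hd : 1 ≤ d) (V : Set (Torus N d)) {t : ℝ} (ht : 0 ≤ t) (x y : Torus N d) :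
    condLaw V t x y = (walkMeasure d).real (survivalSet V t x y) /
      ∑ z : {x : Torus N d // x ∉ V}, (walkMeasure d).real (survivalSet V t x z) := by
  have := isProbabilityMeasure_stepMeasure hd
  have : IsProbabilityMeasure (walkMeasure d) := by rw [walkMeasure_eq_prod]; infer_instance
  have hU : {ω : Sample d | (t : WithTop ℝ) < entranceTime x V ω} =
      ⋃ z, survivalSet V t x z := by
    ext ω; simp [survivalSet]
  have hnull : NullMeasurableSet {ω : Sample d | (t : WithTop ℝ) < entranceTime x V ω}
      (walkMeasure d) := by
    rw [hU]
    exact NullMeasurableSet.iUnion fun z => nullMeasurableSet_survivalSet hd V ht x z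
  have hdisj : Pairwise (Function.onFun (AEDisjoint (walkMeasure d))
      fun z => survivalSet V t x z) := by
    intro z w hzw
    refine Disjoint.aedisjoint (Set.disjoint_left.mpr ?_)
    rintro ω ⟨h1, -⟩ ⟨h2, -⟩
    exact hzw (h1.symm.trans h2)
  have hsum : (walkMeasure d).real {ω : Sample d | (t : WithTop ℝ) < entranceTime x V ω} =
      ∑ z : {x : Torus N d // x ∉ V}, (walkMeasure d).real (survivalSet V t x z) := by
    rw [sum_subtype_eq_sum (F := fun z => (walkMeasure d).real (survivalSet V t x z))
      fun z hz => by rw [measureReal_def, walkMeasure_survivalSet_of_mem hd ht x hz]; rfl]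
    rw [hU, measureReal_def, measure_iUnion₀ hdisj
      (fun z => nullMeasurableSet_survivalSet hd V ht x z), tsum_fintype,
      ENNReal.toReal_sum fun z _ => measure_ne_top _ _]
    rfl
  rw [← hsum, condLaw, ProbabilityTheory.cond, measureReal_def, Measure.smul_apply, Measure.restrict_apply₀' hnull,
    smul_eq_mul, ENNReal.toReal_mul, ENNReal.toReal_inv, div_eq_inv_mul]
  rfl

end Paths

/-! ### Well-posedness of σ and quantitative convergence -/

section Quasistationary

open Matrix
open scoped Classical

variable {N d : ℕ} {V : Set (Torus N d)} {S : Set (ZMod N)}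

lemma nontrivial_compl (hN : 2 ≤ N) (hd : 2 ≤ d) (hV : ∀ x : Torus N d, x ∉ V ↔ ∃ i, x i ∈ S)
    (x : {x : Torus N d // x ∉ V}) : Nontrivial {x : Torus N d // x ∉ V} := by
  have : Fact (1 < N) := ⟨hN⟩
  have : Nontrivial (Fin d) := Fin.nontrivial_iff_two_le.mpr hd
  obtain ⟨i, hi⟩ := (hV x).mp x.2
  obtain ⟨j, hj⟩ := exists_ne i
  set z : Torus N d := Function.update x j ((x : Torus N d) j + 1) with hz
  refine ⟨x, ⟨z, (hV z).mpr ⟨i, by rwa [hz, Function.update_of_ne hj.symm]⟩⟩, fun h => ?_⟩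
  have := congrFun (congrArg Subtype.val h) j
  simp [hz] at this

variable [NeZero N]

lemma IsQuasistationary.exists_pos_eigenvector (hN : 2 ≤ N) (hd : 2 ≤ d)
    (hV : ∀ x : Torus N d, x ∉ V ↔ ∃ i, x i ∈ S) {σ : {x : Torus N d // x ∉ V} → ℝ}
    (hσ : IsQuasistationary V σ) : ∃ (l : ℝ) (v : {x : Torus N d // x ∉ V} → ℝ),
      IsGreatest {m : ℝ | Module.End.HasEigenvalue (Matrix.toLin' (restrictedMatrix V)) m} l ∧
      restrictedMatrix V *ᵥ v = l • v ∧ (∀ x, 0 < v x) ∧ ∀ x, σ x = v x / ∑ z, v z := by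
  obtain ⟨l, v, hl, hv, hnn, hσv⟩ := hσ
  obtain ⟨hv, hv0⟩ := hasEigenvector_toLin'_iff.mp hv
  exact ⟨l, v, hl, hv, pos_of_nonneg_eigenvector (restrictedMatrix_nonneg V)
    (restrictedMatrix_irreducible hN hd hV) hv hv0 hnn, hσv⟩

/-- The quasistationary distribution is well defined. -/
lemma existsUnique_isQuasistationary (hN : 2 ≤ N) (hd : 2 ≤ d)
    (hV : ∀ x : Torus N d, x ∉ V ↔ ∃ i, x i ∈ S) (hne : Vᶜ.Nonempty) :
    ∃! σ : {x : Torus N d // x ∉ V} → ℝ, IsQuasistationary V σ := by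
  have : Nonempty {x : Torus N d // x ∉ V} := hne.to_subtype
  obtain ⟨l, v, hl, hv, hv0, hvn⟩ :=
    exists_nonneg_eigenvector (restrictedMatrix_isSymm V) (restrictedMatrix_nonneg V)
  refine ⟨fun x => v x / ∑ z, v z,
    ⟨l, v, hl, hasEigenvector_toLin'_iff.mpr ⟨hv, hv0⟩, hvn, fun _ => rfl⟩, ?_⟩
  intro σ hσ
  obtain ⟨l', w, hl', hw, hwp, hσw⟩ := hσ.exists_pos_eigenvector hN hd hV
  obtain rfl := hl'.unique hl
  funext x
  rw [hσw x]
  have hirr := restrictedMatrix_irreducible hN hd hV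
  exact eigenvector_normalized_unique (restrictedMatrix_nonneg V) hirr hw hv hwp
    (pos_of_nonneg_eigenvector (restrictedMatrix_nonneg V) hirr hv hv0 hvn) x

lemma div_sum_mem_Ioo {ι : Type*} [Fintype ι] [Nontrivial ι] {w : ι → ℝ} (hw : ∀ x, 0 < w x)
    (y : ι) : w y / ∑ z, w z ∈ Set.Ioo (0 : ℝ) 1 := by
  have hlt : w y < ∑ z, w z := by
    obtain ⟨z, hz⟩ := exists_ne y
    exact Finset.single_lt_sum hz (Finset.mem_univ y) (Finset.mem_univ z) (hw z)
      fun k _ _ => (hw k).le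
  have hpos := (hw y).trans hlt
  exact ⟨div_pos (hw y) hpos, (div_lt_one hpos).mpr hlt⟩

/-- At a fixed positive time, the conditional law and the quasistationary distribution differ by
less than one. -/
lemma abs_condLaw_sub_lt_one (hN : 3 ≤ N) (hd : 2 ≤ d)
    (hV : ∀ x : Torus N d, x ∉ V ↔ ∃ i, x i ∈ S) {t : ℝ} (ht : 0 < t)
    {σ : {x : Torus N d // x ∉ V} → ℝ} (hσ : IsQuasistationary V σ)
    (x y : {x : Torus N d // x ∉ V}) : |condLaw V t x y - σ y| < 1 := by
  have hnt := nontrivial_compl (by omega) hd hV x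
  obtain ⟨l, w, -, -, hwp, hσw⟩ := hσ.exists_pos_eigenvector (by omega) hd hV
  have hK : ∀ z : {x : Torus N d // x ∉ V}, 0 < (walkMeasure d).real (survivalSet V t x z) :=
    fun z => kernel_pos (restrictedMatrix_nonneg V)
      (restrictedMatrix_irreducible (by omega) hd hV x z) ht
      (hasSum_walkMeasure_survivalSet hN (by omega) V ht.le x z)
  have h1 := div_sum_mem_Ioo hwp y
  have h2 := div_sum_mem_Ioo hK y
  rw [condLaw_eq_div (by omega) V ht.le, hσw, abs_lt]
  constructor <;> linarith [h1.1, h1.2, h2.1, h2.2]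

/-- This handles one fixed torus: the error is below 1 at each of finitely many pairs, hence its
maximum `a` is below 1. -/
lemma exists_exp_bound (hN : 3 ≤ N) (hd : 2 ≤ d)
    (hV : ∀ x : Torus N d, x ∉ V ↔ ∃ i, x i ∈ S) {t : ℝ} (ht : 0 < t) {b : ℝ} (hb : 0 ≤ b) :
    ∃ c : ℝ, 0 < c ∧ ∀ σ : {x : Torus N d // x ∉ V} → ℝ, IsQuasistationary V σ →
      ∀ x y : {x : Torus N d // x ∉ V}, |condLaw V t x y - σ y| ≤ Real.exp (-c * b) := by
  by_cases hne : Vᶜ.Nonempty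
  swap
  · exact ⟨1, one_pos, fun σ _ x => absurd ⟨x, x.2⟩ hne⟩
  have : Nonempty {x : Torus N d // x ∉ V} := hne.to_subtype
  obtain ⟨σ, hσ, huniq⟩ := existsUnique_isQuasistationary (by omega) hd hV hne
  obtain ⟨p, hp⟩ := Finite.exists_max
    fun p : {x : Torus N d // x ∉ V} × {x : Torus N d // x ∉ V} =>
      |condLaw V t p.1 p.2 - σ p.2|
  have hp1 := abs_condLaw_sub_lt_one hN hd hV ht hσ p.1 p.2
  set a := |condLaw V t p.1 p.2 - σ p.2|
  -- With this constant the exponent is at least -(1 - a), and exp(-(1 - a)) ≥ a. The denominator `b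
  -- + 1` avoids a division by zero.
  have hpos : 0 < (1 - a) / (b + 1) := div_pos (by linarith) (by linarith)
  refine ⟨_, hpos, fun σ' hσ' x y => ?_⟩
  rw [huniq σ' hσ']
  refine (hp (x, y)).trans ?_
  have h1 : (1 - a) / (b + 1) * b ≤ 1 - a := by
    rw [div_mul_eq_mul_div, div_le_iff₀ (by linarith)]
    nlinarith
  have h2 := Real.add_one_le_exp (-((1 - a) / (b + 1)) * b)
  change a ≤ _
  linarith

/-- Quantitative convergence to the quasistationary distribution when the walk is killed outside
of a union of slabs. -/
lemma abs_condLaw_sub_le {r : ℕ} (hN : 3 ≤ N) (hd : 2 ≤ d) (hr : 1 ≤ r)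
    (hV : ∀ x : Torus N d, x ∉ V ↔ ∃ i, x i ∈ arc N r) {t : ℝ} (ht : 0 ≤ t)
    (hgap : 1 - 6 / (d * (N : ℝ) ^ 2) < 1 - (1 - Real.cos (Real.pi / (N - 2 * r))) / d)
    {σ : {x : Torus N d // x ∉ V} → ℝ} (hσ : IsQuasistationary V σ)
    (x y : {x : Torus N d // x ∉ V}) :
    |condLaw V t x y - σ y| ≤ (N : ℝ) ^ (d + 1) *
      Real.exp (-t * ((6 / (N : ℝ) ^ 2 - (1 - Real.cos (Real.pi / (N - 2 * r)))) / d)) := by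
  obtain ⟨l, w, hl, hw, hwp, hσw⟩ := hσ.exists_pos_eigenvector (by omega) hd hV
  obtain ⟨i, hi⟩ := (hV x).mp x.2
  have hN0 : (0 : ℝ) < N := by positivity
  have hN1 : (1 : ℝ) ≤ N := by exact_mod_cast (by omega : 1 ≤ N)
  have hd2 : (2 : ℝ) ≤ d := by exact_mod_cast hd
  have hfx := arcSine_lower hi
  have hfx0 : 0 < arcSine N r ((x : Torus N d) i) := (by positivity : (0 : ℝ) < 2 / N).trans_le hfx
  have hm : 0 ≤ 1 - (1 - Real.cos (Real.pi / (N - 2 * r))) / d := by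
    rw [sub_nonneg, div_le_one (by linarith)]
    linarith [Real.neg_one_le_cos (Real.pi / (N - 2 * r))]
  have key := abs_kernel_div_sub_le (restrictedMatrix_isSymm V) (restrictedMatrix_nonneg V) hl hw
    hwp (restrictedMatrix_quadratic_le hN (by omega) V) hm hgap
    (f := fun z : {x : Torus N d // x ∉ V} => arcSine N r ((z : Torus N d) i))
    (fun z => (arcSine_nonneg_le_one _).1) (fun z => (arcSine_nonneg_le_one _).2)
    (le_restrictedMatrix_mulVec_arcSine hN (by omega) hr hV i) ht hfx0
    (hasSum_walkMeasure_survivalSet hN (by omega) V ht x) y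
  rw [condLaw_eq_div (by omega) V ht, hσw]
  refine key.trans ?_
  have hcard : (Fintype.card {x : Torus N d // x ∉ V} : ℝ) ≤ (N : ℝ) ^ d := by
    have := Fintype.card_subtype_le fun x : Torus N d => x ∉ V
    rw [Fintype.card_fun, ZMod.card, Fintype.card_fin] at this
    exact_mod_cast this
  have hpow : (1 : ℝ) ≤ (N : ℝ) ^ d := one_le_pow₀ hN1
  have hexp : 1 - (1 - Real.cos (Real.pi / (N - 2 * r))) / d - (1 - 6 / (d * (N : ℝ) ^ 2)) =
      (6 / (N : ℝ) ^ 2 - (1 - Real.cos (Real.pi / (N - 2 * r)))) / d := by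
    field_simp
    ring
  rw [hexp, div_le_iff₀ hfx0]
  set E := Real.exp (-t * ((6 / (N : ℝ) ^ 2 - (1 - Real.cos (Real.pi / (N - 2 * r)))) / d))
  have hE : 0 < E := Real.exp_pos _
  -- The number of states contributes at most 2N^d and the lower bound 2/N of the sine one more
  -- factor N/2.
  calc (1 + (Fintype.card {x : Torus N d // x ∉ V} : ℝ)) * E
      ≤ (2 * (N : ℝ) ^ d) * E := mul_le_mul_of_nonneg_right (by linarith) hE.le
    _ = (N : ℝ) ^ (d + 1) * E * (2 / N) := by rw [pow_succ]; field_simp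
    _ ≤ _ := mul_le_mul_of_nonneg_left hfx (by positivity)

/-- This is where 6 > π²/2 enters: for `r ≤ n / 40` the angle is at most 3.15/(0.95 n), its square
is below 11/n², and 6 - 11/2 = 1/2. -/
lemma half_div_sq_le {n r : ℝ} (hn : 0 < n) (hr : r ≤ n / 40) :
    1 / 2 / n ^ 2 ≤ 6 / n ^ 2 - (1 - Real.cos (Real.pi / (n - 2 * r))) := by
  have hL : 0.95 * n ≤ n - 2 * r := by linarith
  have hL0 : 0 < 0.95 * n := by positivity
  have h1 := Real.one_sub_sq_div_two_le_cos (x := Real.pi / (n - 2 * r))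
  have h2 : Real.pi / (n - 2 * r) ≤ 3.15 / (0.95 * n) :=
    div_le_div₀ (by norm_num) Real.pi_lt_d2.le hL0 hL
  have h3 : (Real.pi / (n - 2 * r)) ^ 2 ≤ (3.15 / (0.95 * n)) ^ 2 :=
    pow_le_pow_left₀ (div_nonneg Real.pi_pos.le (hL0.le.trans hL)) h2 2
  have h4 : (3.15 / (0.95 * n)) ^ 2 = (3.15 / 0.95) ^ 2 / n ^ 2 := by
    rw [← div_div, div_pow]
  have h5 : (3.15 / 0.95 : ℝ) ^ 2 / n ^ 2 ≤ 11 / n ^ 2 :=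
    div_le_div_of_nonneg_right (by norm_num) (by positivity)
  have h6 : 1 / 2 / n ^ 2 = 6 / n ^ 2 - 11 / n ^ 2 / 2 := by ring
  rw [h6]
  linarith

end Quasistationary

/-! ### The box `B`: large tori, small tori, common constant -/

section Box

variable {d : ℕ} {ε : ℝ}

lemma notMem_boxB_iff {N : ℕ} [NeZero N] (x : Torus N d) :
    x ∉ boxB N d ε ↔ ∃ i, x i ∈ arc N ⌊(N : ℝ) ^ (1 - ε / 2)⌋₊ :=
  notMem_box_iff (Real.rpow_nonneg (Nat.cast_nonneg N) _) x

lemma one_le_radius {N : ℕ} [NeZero N] (hε : ε ∈ Set.Ioo (0 : ℝ) 1) :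
    1 ≤ ⌊(N : ℝ) ^ (1 - ε / 2)⌋₊ := by
  rw [Nat.one_le_floor_iff]
  refine Real.one_le_rpow ?_ (by linarith [hε.2])
  exact_mod_cast NeZero.one_le

lemma three_le_of_notMem_boxB {N : ℕ} [NeZero N] (hε : ε ∈ Set.Ioo (0 : ℝ) 1) {x : Torus N d}
    (hx : x ∉ boxB N d ε) : 3 ≤ N := by
  obtain ⟨i, h1, h2⟩ := (notMem_boxB_iff x).mp hx
  have := one_le_radius (N := N) hε
  omega

/-- The conditional law at time `(N log N)^2` is within `exp (-c log² N)` of every quasistationary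
distribution. -/
def HasExpBound (d : ℕ) (ε c : ℝ) (N : ℕ) : Prop :=
  ∀ [NeZero N], ∀ σ : {x : Torus N d // x ∉ boxB N d ε} → ℝ,
    IsQuasistationary (boxB N d ε) σ → ∀ x y : {x : Torus N d // x ∉ boxB N d ε},
      |condLaw (boxB N d ε) (regTime N) x y - σ y| ≤ Real.exp (-c * Real.log N ^ 2)

lemma HasExpBound.mono {c c' : ℝ} {N : ℕ} (hc : c' ≤ c) (h : HasExpBound d ε c N) :
    HasExpBound d ε c' N := fun σ hσ x y => (h σ hσ x y).trans
  (Real.exp_le_exp.mpr (mul_le_mul_of_nonneg_right (neg_le_neg hc) (sq_nonneg _)))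

/-- The bound for a fixed size of the torus. -/
lemma exists_bound_of_size (hd : 3 ≤ d) (hε : ε ∈ Set.Ioo (0 : ℝ) 1) (N : ℕ) :
    ∃ c : ℝ, 0 < c ∧ HasExpBound d ε c N := by
  rcases lt_or_ge N 3 with hN | hN
  · refine ⟨1, one_pos, fun σ _ x => ?_⟩
    have := three_le_of_notMem_boxB hε x.2
    omega
  · have : NeZero N := ⟨by omega⟩
    have hN1 : (1 : ℝ) < N := by exact_mod_cast (by omega : 1 < N)
    have ht : 0 < regTime N := by
      have := Real.log_pos hN1
      unfold regTime; positivity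
    obtain ⟨c, hc, h⟩ := exists_exp_bound hN (by omega) (notMem_boxB_iff (d := d) (ε := ε)) ht
      (sq_nonneg (Real.log N))
    exact ⟨c, hc, h⟩

/-- The bound for large tori. -/
lemma exists_bound_of_large (hd : 3 ≤ d) (hε : ε ∈ Set.Ioo (0 : ℝ) 1) :
    ∃ N₀ : ℕ, ∀ N ≥ N₀, HasExpBound d ε (1 / (4 * (d : ℝ))) N := by
  -- As N^(1-ε/2) = N/N^(ε/2), this gives a radius of at most N/40.
  have h1 : ∀ᶠ N : ℕ in Filter.atTop, (40 : ℝ) ≤ (N : ℝ) ^ (ε / 2) :=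
    ((tendsto_rpow_atTop (by linarith [hε.1])).comp
      tendsto_natCast_atTop_atTop).eventually_ge_atTop 40
  -- Then N^(d+1) ≤ exp(log² N/(4d)), so the prefactor uses up only half of the decay exp(-log²
  -- N/(2d)).
  have h2 : ∀ᶠ N : ℕ in Filter.atTop, 4 * (d : ℝ) * (d + 1) ≤ Real.log N :=
    (Real.tendsto_log_atTop.comp tendsto_natCast_atTop_atTop).eventually_ge_atTop _
  obtain ⟨N₀, hN₀⟩ := Filter.eventually_atTop.mp (h1.and h2)
  refine ⟨N₀, fun N hN _ σ hσ x y => ?_⟩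
  obtain ⟨hN1, hN2⟩ := hN₀ N hN
  have hN3 := three_le_of_notMem_boxB hε x.2
  have hn : (0 : ℝ) < N := by positivity
  have hd0 : (0 : ℝ) < d := by positivity
  set r := ⌊(N : ℝ) ^ (1 - ε / 2)⌋₊ with hr_def
  have hr : (r : ℝ) ≤ N / 40 := by
    refine (Nat.floor_le (by positivity)).trans ?_
    rw [Real.rpow_sub hn, Real.rpow_one]
    exact div_le_div_of_nonneg_left hn.le (by norm_num) hN1
  have hgap := half_div_sq_le hn hr
  have hpos : 0 < 1 / 2 / (N : ℝ) ^ 2 := by positivity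
  refine (abs_condLaw_sub_le hN3 (by omega) (one_le_radius hε) notMem_boxB_iff
    (sq_nonneg _) ?_ hσ x y).trans ?_
  · rw [sub_lt_sub_iff_left, ← hr_def]
    have : 6 / (d * (N : ℝ) ^ 2) = 6 / (N : ℝ) ^ 2 / d := by field_simp
    rw [this]
    exact div_lt_div_of_pos_right (by linarith) hd0
  · rw [← hr_def]
    have h3 : (N : ℝ) ^ (d + 1) = Real.exp ((d + 1) * Real.log N) := by
      rw [mul_comm, Real.exp_mul, Real.exp_log hn]
      exact_mod_cast (Real.rpow_natCast (N : ℝ) (d + 1)).symm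
    rw [h3, ← Real.exp_add, Real.exp_le_exp]
    have h4 : Real.log N ^ 2 * (1 / (2 * d)) ≤ regTime N *
        ((6 / (N : ℝ) ^ 2 - (1 - Real.cos (Real.pi / (N - 2 * r)))) / d) := by
      have e : Real.log N ^ 2 * (1 / (2 * d)) = regTime N * (1 / 2 / (N : ℝ) ^ 2 / d) := by
        unfold regTime; field_simp
      rw [e]
      exact mul_le_mul_of_nonneg_left (div_le_div_of_nonneg_right hgap hd0.le) (sq_nonneg _)
    unfold regTime at h4
    have hlog : 0 ≤ Real.log N := le_trans (by positivity) hN2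
    have h5 : (d + 1) * Real.log N ≤ 1 / (4 * (d : ℝ)) * Real.log N ^ 2 := by
      have := mul_le_mul_of_nonneg_right hN2 hlog
      rw [div_mul_eq_mul_div, one_mul, le_div_iff₀ (by positivity)]
      linarith
    have h6 : Real.log N ^ 2 * (1 / (2 * (d : ℝ))) =
        2 * (1 / (4 * (d : ℝ)) * Real.log N ^ 2) := by
      field_simp; norm_num
    linarith

/-- A common constant for finitely many indices. -/
lemma exists_pos_forall_lt {P : ℝ → ℕ → Prop} (hP : ∀ {c c' n}, c' ≤ c → P c n → P c' n)
    (h : ∀ n, ∃ c, 0 < c ∧ P c n) (m : ℕ) : ∃ c, 0 < c ∧ ∀ n < m, P c n := by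
  induction m with
  | zero => exact ⟨1, one_pos, fun n hn => absurd hn (Nat.not_lt_zero n)⟩
  | succ m ih =>
    obtain ⟨c, hc, hm⟩ := ih
    obtain ⟨c', hc', hm'⟩ := h m
    refine ⟨min c c', lt_min hc hc', fun n hn => ?_⟩
    rcases Nat.lt_succ_iff_lt_or_eq.mp hn with hn | rfl
    · exact hP (min_le_left _ _) (hm n hn)
    · exact hP (min_le_right _ _) hm'

end Box

end TorusWalk

theorem lemma3p8 (d : ℕ) (hd : 3 ≤ d) (ε : ℝ) (hε : ε ∈ Set.Ioo (0 : ℝ) 1) :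
    ∃ c : ℝ, 0 < c ∧ ∀ (N : ℕ) [NeZero N],
      ((TorusWalk.boxB N d ε)ᶜ.Nonempty →
        ∃! σ : {x : TorusWalk.Torus N d // x ∉ TorusWalk.boxB N d ε} → ℝ,
          TorusWalk.IsQuasistationary (TorusWalk.boxB N d ε) σ) ∧
      ∀ σ : {x : TorusWalk.Torus N d // x ∉ TorusWalk.boxB N d ε} → ℝ,
        TorusWalk.IsQuasistationary (TorusWalk.boxB N d ε) σ →
        ∀ x y : {x : TorusWalk.Torus N d // x ∉ TorusWalk.boxB N d ε},
          |TorusWalk.condLaw (TorusWalk.boxB N d ε) (TorusWalk.regTime N) x y - σ y| ≤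
            Real.exp (-c * Real.log N ^ 2) := by
  obtain ⟨N₀, hlarge⟩ := TorusWalk.exists_bound_of_large hd hε
  obtain ⟨c, hc, hsmall⟩ := TorusWalk.exists_pos_forall_lt
    (P := TorusWalk.HasExpBound d ε) (fun hcc' h => h.mono hcc')
    (TorusWalk.exists_bound_of_size hd hε) N₀
  have hd0 : (0 : ℝ) < d := by positivity
  refine ⟨min c (1 / (4 * d)), lt_min hc (by positivity), fun N _ => ⟨fun hne => ?_, ?_⟩⟩
  · obtain ⟨x, hx⟩ := hne
    have hN := TorusWalk.three_le_of_notMem_boxB hε hx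
    exact TorusWalk.existsUnique_isQuasistationary (by omega) (by omega)
      TorusWalk.notMem_boxB_iff ⟨x, hx⟩
  · intro σ hσ x y
    rcases lt_or_ge N N₀ with hN | hN
    · exact TorusWalk.HasExpBound.mono (min_le_left _ _) (hsmall N hN) σ hσ x y
    · exact TorusWalk.HasExpBound.mono (min_le_right _ _) (hlarge N hN) σ hσ x y
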